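/- Let $d\ge 2$, $\Omega=(-1,1)^d$ and $3\Omega=(-3,3)^d$, let $0<s<t<1$ and $p,q\in(1,\infty)$, and suppose that $$t-\frac dq>s-\frac dp .$$ Then there exist a measurable, symmetric, bounded, nonnegative, Hölder continuous weight $a:\mathbb R^d\times\mathbb R^d\to[0,\infty)$ (that is, $a\in C^{\alpha}\cap L^\infty(\mathbb R^d\times\mathbb R^d)$ for some $\alpha\in(0,1]$) with $a(x,y)=0$ whenever $x\notin 3\Omega$ or $y\notin 3\Omega$, and a boundary datum $u_D\in C^\infty(\overline\Omega)\cap L^\infty(\mathbb R^d)$ with $u_D=0$ outside $3\Omega$, such that the nonlocal double-phase energy $$\mathcal J(v)=\int_{\mathbb R^d}\!\int_{\mathbb R^d}\frac1p\,\frac{|v(x)-v(y)|^p}{|x-y|^{d+sp}}\,dx\,dy+\int_{\mathbb R^d}\!\int_{\mathbb R^d}\frac1q\,a(x,y)\,\frac{|v(x)-v(y)|^q}{|x-y|^{d+tq}}\,dx\,dy$$ has a Lavrentiev gap: $$\inf \mathcal J\big(W_{u_D}(\Omega)\big)<\inf\mathcal J\big(H_{u_D}(\Omega)\big).$$ Here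 $W_{u_D}(\Omega)=u_D+W_0(\Omega)$ and $H_{u_D}(\Omega)=u_D+H_0(\Omega)$, where $W_0(\Omega)=\{v\in L^1_{\rm loc}(\mathbb R^d):\mathcal J(v)<\infty,\ v=0 \text{ a.e. on } \mathbb R^d\setminus\Omega\}$, and $H_0(\Omega)$ is the closure of $C_0^\infty(\Omega)$ in $W_0(\Omega)$ with respect to the norm $\|v\|_{\mathcal J}=\inf\{\lambda>0:\mathcal J(v/\lambda)\le1\}$. -/

import Mathlib

open MeasureTheory
open scoped ContDiff

namespace DoublePhase

noncomputable section

/-- The open cube `(-r, r)^d` in `ℝ^d` (with its Euclidean norm). -/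
def cube (d : ℕ) (r : ℝ) : Set (EuclideanSpace ℝ (Fin d)) :=
  {x | ∀ i, -r < x i ∧ x i < r}

/-- The fractional phase
`(1/p) ∫∫ b(x,y) |v(x) - v(y)|^p / |x - y|^(d + s p) dx dy` with weight `b`, with values in `[0, ∞]`.
On the diagonal (a null set) the integrand is `0` by the conventions for division. -/
def phase (d : ℕ) (s p : ℝ) (b : EuclideanSpace ℝ (Fin d) → EuclideanSpace ℝ (Fin d) → ℝ)
    (v : EuclideanSpace ℝ (Fin d) → ℝ) : ENNReal :=
  ∫⁻ x, ∫⁻ y, ENNReal.ofReal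
    (1 / p * (b x y * (|v x - v y| ^ p / ‖x - y‖ ^ ((d : ℝ) + s * p))))

/-- The nonlocal double phase energy
`J(v) = (1/p) ∫∫ |v(x) - v(y)|^p / |x - y|^(d + s p) + (1/q) ∫∫ a(x,y) |v(x) - v(y)|^q / |x - y|^(d + t q)`,
where both double integrals are over `ℝ^d × ℝ^d`. -/
def energy (d : ℕ) (s t p q : ℝ) (a : EuclideanSpace ℝ (Fin d) → EuclideanSpace ℝ (Fin d) → ℝ)
    (v : EuclideanSpace ℝ (Fin d) → ℝ) : ENNReal :=
  phase d s p (fun _ _ => 1) v + phase d t q a v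

/-- The Luxemburg norm `inf {r > 0 : J(v / r) ≤ 1}` of a modular `J`, with `inf ∅ = ∞`. -/
def luxemburgNorm {X : Type*} (J : (X → ℝ) → ENNReal) (v : X → ℝ) : ENNReal :=
  ⨅ (r : ℝ) (_ : 0 < r) (_ : J (fun x => v x / r) ≤ 1), ENNReal.ofReal r

/-- `W₀(Ω)`: locally integrable functions on `ℝ^d` of finite energy that vanish (almost everywhere)
outside `Ω`. -/
def W₀ {d : ℕ} (J : (EuclideanSpace ℝ (Fin d) → ℝ) → ENNReal)
    (Ω : Set (EuclideanSpace ℝ (Fin d))) : Set (EuclideanSpace ℝ (Fin d) → ℝ) :=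
  {v | LocallyIntegrable v volume ∧ J v < ⊤ ∧ ∀ᵐ x ∂volume, x ∉ Ω → v x = 0}

/-- `C₀^∞(Ω)`: smooth functions on `ℝ^d` with compact support contained in `Ω`. -/
def testFunctions {d : ℕ} (Ω : Set (EuclideanSpace ℝ (Fin d))) :
    Set (EuclideanSpace ℝ (Fin d) → ℝ) :=
  {φ | ContDiff ℝ ∞ φ ∧ HasCompactSupport φ ∧ tsupport φ ⊆ Ω}

/-- `H₀(Ω)`: the closure of `C₀^∞(Ω)` in `W₀(Ω)` with respect to the Luxemburg norm of `J`. -/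
def H₀ {d : ℕ} (J : (EuclideanSpace ℝ (Fin d) → ℝ) → ENNReal)
    (Ω : Set (EuclideanSpace ℝ (Fin d))) : Set (EuclideanSpace ℝ (Fin d) → ℝ) :=
  {w | w ∈ W₀ J Ω ∧
    ∀ ε : ENNReal, 0 < ε → ∃ φ ∈ testFunctions Ω, luxemburgNorm J (fun x => w x - φ x) < ε}

/-- `W_u(Ω) = u + W₀(Ω)`. -/
def W {d : ℕ} (J : (EuclideanSpace ℝ (Fin d) → ℝ) → ENNReal)
    (Ω : Set (EuclideanSpace ℝ (Fin d))) (u : EuclideanSpace ℝ (Fin d) → ℝ) :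
    Set (EuclideanSpace ℝ (Fin d) → ℝ) :=
  {v | ∃ w ∈ W₀ J Ω, v = u + w}

/-- `H_u(Ω) = u + H₀(Ω)`. -/
def H {d : ℕ} (J : (EuclideanSpace ℝ (Fin d) → ℝ) → ENNReal)
    (Ω : Set (EuclideanSpace ℝ (Fin d))) (u : EuclideanSpace ℝ (Fin d) → ℝ) :
    Set (EuclideanSpace ℝ (Fin d) → ℝ) :=
  {v | ∃ w ∈ H₀ J Ω, v = u + w}

end

end DoublePhase

/-!
The gap exists because the two phases see different aspects of a self-similar staircase. Fix
`σ ∈ (s, t)`. The staircase `g : ℝ → ℝ` rises from `0` to `1` inside `(-1/2, 1/2)`. At each step of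
its construction, an interval is replaced by `M * K` child intervals of relative length `1 / R`,
`R = 4 M K`: they form `K` successive traverses of the range of `g`, alternately upwards and
downwards, each consisting of `M` steps; the rest of the interval becomes flat. If `M ≥ 2 R ^ σ`,
then `g` is `σ`-Hölder (`exists_staircase`), so a compactly supported competitor that equals
`g (x 0)` in a box has finite fractional phase of order `s < σ` for every exponent `p`
(`phase_lt_top`).

The weight charges only pairs `(x, y)` of points in the flat part with `g (x 0) = g (y 0)`, in
proportion to a small power `α` of the distance to the complement of the flat part. Hence the
weighted phase of the competitor vanishes, whatever constant `m` the weight is multiplied by, while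
its other phase is a fixed finite number. The weight is Hölder continuous because moving a point by
less than its distance to the complement of the flat part does not change the value of `g`.

For a Lipschitz function `v`, let `drop v` be the difference of the averages of `v` over two plates
to the right and to the left of the staircase. The plates of the children of the box are linked to
one another, and to the two large plates, by pairs charged by the weight. So each traverse
telescopes, and `drop v` is bounded by the energy plus the average over the traverses of the sum of
the `M` drops on the children (`abs_drop_le_sum`). The energies of the rescaled functions
`v ∘ sub N i` add up to at most `R ^ (d - t q + α)` times the energy of `v`
(`sum_phase_comp_sub_le`). By Hölder's inequality, passing to the children multiplies the bound by
a factor less than one as soon as `4 M ^ q R ^ α < R ^ (t q)`, while the Lipschitz constant is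
divided by `R > M`; both requirements on `M` and `R` can be met since `σ < t`
(`exists_parameters`). Iteration gives `|drop v| ≤ C * energy ^ (1 / q)` with no dependence on the
Lipschitz constant (`exists_abs_drop_le`). Functions with the boundary values of the datum have
drop `1`, so their weighted phase is bounded below, and the bound passes to the closure of the test
functions (`exists_le_phase_of_mem_H`). Multiplying the weight by a large `m` therefore raises the
infimum over `H` above the energy of the competitor.
-/

namespace DoublePhase

/-! ### The self-similar staircase -/

/-- A smooth substitute for the triangular wave: it maps even integers to `0` and odd integers
to `1`. -/
noncomputable def fold (y : ℝ) : ℝ := (1 - Real.cos (Real.pi * y)) / 2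

lemma fold_nonneg (y : ℝ) : 0 ≤ fold y := by
  unfold fold; linarith [Real.cos_le_one (Real.pi * y)]

lemma fold_le_one (y : ℝ) : fold y ≤ 1 := by
  unfold fold; linarith [Real.neg_one_le_cos (Real.pi * y)]

lemma fold_natCast (k : ℕ) : fold k = (1 - (-1) ^ k) / 2 := by
  rw [fold, mul_comm, Real.cos_nat_mul_pi]

lemma abs_fold_sub_fold_le (x y : ℝ) : |fold x - fold y| ≤ 2 * |x - y| := by
  have h := Real.abs_cos_sub_cos_le (Real.pi * x) (Real.pi * y)
  rw [← mul_sub, abs_mul, abs_of_pos Real.pi_pos] at h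
  have h2 : fold x - fold y = -((Real.cos (Real.pi * x) - Real.cos (Real.pi * y)) / 2) := by
    unfold fold; ring
  rw [h2, abs_neg, abs_div, abs_of_pos (by norm_num : (0 : ℝ) < 2)]
  nlinarith [Real.pi_le_four, abs_nonneg (x - y)]

/-- At most one of the points `x, x - 4, x - 8, …` lies in `(-2, 2)`. -/
lemma abs_sum_translates_le {f : ℝ → ℝ} {B : ℝ} (hB : 0 ≤ B) (hf : ∀ z, |f z| ≤ B)
    (h0 : ∀ z, 2 ≤ |z| → f z = 0) (x : ℝ) (N : ℕ) :
    |∑ i ∈ Finset.range N, f (x - 4 * i)| ≤ B := by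
  by_cases h : ∃ j ∈ Finset.range N, f (x - 4 * j) ≠ 0
  · obtain ⟨j, hj, hne⟩ := h
    rw [Finset.sum_eq_single_of_mem j hj]
    · exact hf _
    intro i _ hij
    apply h0
    have hj2 : |x - 4 * j| < 2 := by
      by_contra hc
      exact hne (h0 _ (not_lt.mp hc))
    rw [abs_lt] at hj2
    rcases lt_or_gt_of_ne hij with h | h
    · have : (i : ℝ) + 1 ≤ j := by exact_mod_cast h
      exact le_abs.mpr (Or.inl (by linarith))
    · have : (j : ℝ) + 1 ≤ i := by exact_mod_cast h
      exact le_abs.mpr (Or.inr (by linarith))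
  · push Not at h
    rw [Finset.sum_eq_zero h]
    simpa using hB

/-- The centre of the `i`-th of the `N` intervals of length `1 / N` that fill `(-1/2, 1/2)`. -/
noncomputable def center (N i : ℕ) : ℝ := (4 * i + 2) / (4 * N) - 1 / 2

/-- One refinement step of the staircase: `M * K` rescaled copies of `g` are lined up, each of
height `1 / M`, and the resulting ascent of height `K` is folded into the interval `[0, 1]`. The
copies are scaled by `4 * (M * K)`, so that each occupies a quarter of its child interval and the
rest is flat. -/
noncomputable def refine (M K : ℕ) (g : ℝ → ℝ) (x : ℝ) : ℝ :=
  fold ((∑ i ∈ Finset.range (M * K), g (4 * (M * K : ℕ) * (x - center (M * K) i))) / M)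

/-- Functions that rise from `0` to `1` inside `(-1/2, 1/2)`. -/
structure IsStep (g : ℝ → ℝ) : Prop where
  left : ∀ x, x ≤ -1 / 2 → g x = 0
  right : ∀ x, 1 / 2 ≤ x → g x = 1
  nonneg : ∀ x, 0 ≤ g x
  le_one : ∀ x, g x ≤ 1

lemma IsStep.abs_sub_le {g h : ℝ → ℝ} (hg : IsStep g) (hh : IsStep h) (x y : ℝ) :
    |g x - h y| ≤ 1 := by
  rw [abs_le]
  constructor <;> linarith [hg.nonneg x, hg.le_one x, hh.nonneg y, hh.le_one y]

section Refine

variable {M K : ℕ} {g h : ℝ → ℝ}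

lemma scaled_sub_center (hN : 0 < M * K) (x : ℝ) (i : ℕ) :
    4 * (M * K : ℕ) * (x - center (M * K) i)
      = (4 * (M * K : ℕ) * (x + 1 / 2) - 2) - 4 * i := by
  have : ((M * K : ℕ) : ℝ) ≠ 0 := by positivity
  unfold center
  field_simp
  ring

lemma refine_eq (hN : 0 < M * K) (g : ℝ → ℝ) (x : ℝ) :
    refine M K g x = fold ((∑ i ∈ Finset.range (M * K),
      g ((4 * (M * K : ℕ) * (x + 1 / 2) - 2) - 4 * i)) / M) := by
  simp only [refine, scaled_sub_center hN]

/-- On the `i`-th child interval, all earlier copies have reached `1` and no later one has left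
`0`. -/
lemma refine_center (hN : 0 < M * K) (hg : IsStep g) {i : ℕ} (hi : i < M * K) {y : ℝ}
    (hy : |y| ≤ 2) :
    refine M K g (y / (4 * (M * K : ℕ)) + center (M * K) i) = fold ((i + g y) / M) := by
  have hN' : ((M * K : ℕ) : ℝ) ≠ 0 := by positivity
  rw [abs_le] at hy
  have hx : ∀ j : ℕ, 4 * ((M * K : ℕ) : ℝ) * (y / (4 * (M * K : ℕ)) + center (M * K) i
      - center (M * K) j) = y + 4 * (i - j) := by
    intro j
    unfold center
    field_simp
    ring
  unfold refine
  simp only [hx]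
  congr 2
  rw [Finset.range_eq_Ico, ← Finset.sum_Ico_consecutive _ (Nat.zero_le i) hi.le,
    Finset.sum_eq_sum_Ico_succ_bot hi]
  have h1 : ∑ j ∈ Finset.Ico 0 i, g (y + 4 * ((i : ℝ) - j)) = i := by
    rw [Finset.sum_congr rfl (g := fun _ => (1 : ℝ))]
    · simp
    intro j hj
    have : (j : ℝ) + 1 ≤ i := by exact_mod_cast (Finset.mem_Ico.mp hj).2
    exact hg.right _ (by linarith)
  have h2 : ∑ j ∈ Finset.Ico (i + 1) (M * K), g (y + 4 * ((i : ℝ) - j)) = 0 := by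
    apply Finset.sum_eq_zero
    intro j hj
    have : (i : ℝ) + 1 ≤ j := by exact_mod_cast (Finset.mem_Ico.mp hj).1
    exact hg.left _ (by linarith)
  rw [h1, h2]
  simp

lemma IsStep.refine (hM : 0 < M) (hK : Odd K) (hg : IsStep g) : IsStep (refine M K g) := by
  have hN : 0 < M * K := Nat.mul_pos hM hK.pos
  have hNr : (1 : ℝ) ≤ (M * K : ℕ) := by exact_mod_cast hN
  refine ⟨fun x hx => ?_, fun x hx => ?_, fun x => fold_nonneg _, fun x => fold_le_one _⟩
  · rw [refine_eq hN, Finset.sum_eq_zero]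
    · simp [fold]
    intro i _
    apply hg.left
    have : (0 : ℝ) ≤ i := by positivity
    nlinarith
  · rw [refine_eq hN, Finset.sum_congr rfl (g := fun _ => (1 : ℝ))]
    · have : ((M : ℝ) * K) / M = K := by field_simp
      simp only [Finset.sum_const, Finset.card_range, nsmul_eq_mul, mul_one, Nat.cast_mul, this]
      rw [fold_natCast, hK.neg_one_pow]
      norm_num
    intro i hi
    apply hg.right
    have : (i : ℝ) + 1 ≤ (M * K : ℕ) := by exact_mod_cast Finset.mem_range.mp hi
    nlinarith

lemma abs_refine_sub_refine_le (hM : 0 < M) (hK : 0 < K) (hg : IsStep g) (hh : IsStep h)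
    {B : ℝ} (hB : ∀ x, |g x - h x| ≤ B) (x : ℝ) :
    |refine M K g x - refine M K h x| ≤ 2 / M * B := by
  have hN : 0 < M * K := Nat.mul_pos hM hK
  have hB0 : 0 ≤ B := (abs_nonneg _).trans (hB 0)
  have hM' : (0 : ℝ) < M := by positivity
  rw [refine_eq hN, refine_eq hN]
  refine (abs_fold_sub_fold_le _ _).trans ?_
  rw [← sub_div, ← Finset.sum_sub_distrib, abs_div, abs_of_pos hM']
  have := abs_sum_translates_le hB0 hB (f := fun z => g z - h z) ?_
    (4 * (M * K : ℕ) * (x + 1 / 2) - 2) (M * K)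
  · rw [div_mul_eq_mul_div, mul_div_assoc]
    gcongr
  · intro z hz
    rcases le_abs.mp hz with h1 | h1
    · simp [hg.right z (by linarith), hh.right z (by linarith)]
    · simp [hg.left z (by linarith), hh.left z (by linarith)]

/-- Refinement preserves a Hölder bound as soon as the height `1 / M` of a copy is small compared
with the power `σ` of its width. -/
lemma abs_refine_sub_le (hM : 0 < M) (hK : Odd K) (hg : IsStep g) {σ : ℝ} (hσ : 0 < σ)
    (hMσ : 2 * (4 * (M * K : ℕ) : ℝ) ^ σ ≤ M)
    (hH : ∀ x y, |g x - g y| ≤ (4 * (M * K : ℕ) * |x - y|) ^ σ) (x y : ℝ) :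
    |refine M K g x - refine M K g y| ≤ (4 * (M * K : ℕ) * |x - y|) ^ σ := by
  have hN : 0 < M * K := Nat.mul_pos hM hK.pos
  have hM' : (0 : ℝ) < M := by positivity
  set R : ℝ := 4 * (M * K : ℕ) with hR
  have hR0 : 0 < R := by positivity
  by_cases hxy : 1 ≤ R * |x - y|
  · exact ((hg.refine hM hK).abs_sub_le (hg.refine hM hK) x y).trans
      (Real.one_le_rpow hxy hσ.le)
  push Not at hxy
  rw [refine_eq hN, refine_eq hN]
  refine (abs_fold_sub_fold_le _ _).trans ?_
  rw [← sub_div, ← Finset.sum_sub_distrib, abs_div, abs_of_pos hM', ← hR]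
  set δ : ℝ := R * (y - x) with hδ
  have hδ1 : |δ| = R * |x - y| := by rw [hδ, abs_mul, abs_of_pos hR0, abs_sub_comm]
  have hδ2 := abs_lt.mp (hδ1.trans_lt hxy)
  have key := abs_sum_translates_le (f := fun z => g z - g (z + δ)) (B := (R * |δ|) ^ σ)
    (by positivity) (fun z => by simpa using hH z (z + δ)) ?_ (R * (x + 1 / 2) - 2) (M * K)
  · have e : ∀ i : ℕ, R * (y + 1 / 2) - 2 - 4 * i = R * (x + 1 / 2) - 2 - 4 * i + δ := by
      intro i; rw [hδ]; ring
    simp only [e]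
    calc 2 * (|∑ i ∈ Finset.range (M * K), (g (R * (x + 1 / 2) - 2 - 4 * i)
          - g (R * (x + 1 / 2) - 2 - 4 * i + δ))| / M)
        ≤ 2 * ((R * |δ|) ^ σ / M) := by gcongr
      _ = (2 * R ^ σ) / M * (R * |x - y|) ^ σ := by
          rw [Real.mul_rpow hR0.le (abs_nonneg _), hδ1]; ring
      _ ≤ 1 * (R * |x - y|) ^ σ := by
          gcongr
          exact (div_le_one hM').mpr hMσ
      _ = _ := one_mul _
  · intro z hz
    rcases le_abs.mp hz with h1 | h1
    · simp [hg.right z (by linarith), hg.right (z + δ) (by linarith)]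
    · simp [hg.left z (by linarith), hg.left (z + δ) (by linarith)]

end Refine

/-- The fractal staircase: a `σ`-Hölder step function that is a fixed point of `refine M K`. -/
theorem exists_staircase {M K : ℕ} {σ : ℝ} (hM : 0 < M) (hK : Odd K) (hσ : 0 < σ) (hσ1 : σ ≤ 1)
    (hMσ : 2 * (4 * (M * K : ℕ) : ℝ) ^ σ ≤ M) :
    ∃ g : ℝ → ℝ, IsStep g ∧ (∀ x y, |g x - g y| ≤ (4 * (M * K : ℕ) * |x - y|) ^ σ) ∧
      ∀ i < M * K, ∀ y, |y| ≤ 2 →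
        g (y / (4 * (M * K : ℕ)) + center (M * K) i) = fold ((i + g y) / M) := by
  have hN : 0 < M * K := Nat.mul_pos hM hK.pos
  have hM' : (0 : ℝ) < M := by positivity
  have hNr : (1 : ℝ) ≤ (M * K : ℕ) := by exact_mod_cast hN
  have hR1 : (1 : ℝ) < 4 * (M * K : ℕ) := by linarith
  have hM2 : (2 : ℝ) / M < 1 := by
    rw [div_lt_one hM']
    have := Real.one_lt_rpow hR1 hσ
    linarith
  let g₀ : ℝ → ℝ := fun x => max 0 (min 1 (x + 1 / 2))
  have hg₀ : IsStep g₀ := by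
    refine ⟨fun x hx => ?_, fun x hx => ?_, fun x => le_max_left _ _, fun x => ?_⟩
    · exact max_eq_left ((min_le_right _ _).trans (by linarith))
    · simp only [g₀]
      rw [min_eq_left (by linarith)]; norm_num
    · exact max_le zero_le_one (min_le_left _ _)
  have hH₀ : ∀ x y, |g₀ x - g₀ y| ≤ (4 * (M * K : ℕ) * |x - y|) ^ σ := by
    intro x y
    by_cases hxy : 1 ≤ 4 * (M * K : ℕ) * |x - y|
    · exact (hg₀.abs_sub_le hg₀ x y).trans (Real.one_le_rpow hxy hσ.le)
    push Not at hxy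
    have h1 : |g₀ x - g₀ y| ≤ |x - y| := by
      have h2 := abs_max_sub_max_le_max 0 (min 1 (x + 1 / 2)) 0 (min 1 (y + 1 / 2))
      have h3 := abs_min_sub_min_le_max 1 (x + 1 / 2) 1 (y + 1 / 2)
      simp only [sub_self, abs_zero, add_sub_add_right_eq_sub, abs_nonneg, sup_of_le_right] at h2 h3
      exact h2.trans h3
    calc |g₀ x - g₀ y| ≤ |x - y| := h1
      _ ≤ 4 * (M * K : ℕ) * |x - y| := le_mul_of_one_le_left (abs_nonneg _) hR1.le
      _ ≤ _ := Real.self_le_rpow_of_le_one (by positivity) hxy.le hσ1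
  let G : ℕ → ℝ → ℝ := fun n => (refine M K)^[n] g₀
  have hGs : ∀ n, G (n + 1) = refine M K (G n) := fun n => Function.iterate_succ_apply' _ _ _
  have hG : ∀ n, IsStep (G n) := by
    intro n
    induction n with
    | zero => exact hg₀
    | succ n ih => rw [hGs]; exact ih.refine hM hK
  have hH : ∀ n x y, |G n x - G n y| ≤ (4 * (M * K : ℕ) * |x - y|) ^ σ := by
    intro n
    induction n with
    | zero => exact hH₀
    | succ n ih => rw [hGs]; exact abs_refine_sub_le hM hK (hG n) hσ hMσ ih
  have hC : ∀ n x, |G n x - G (n + 1) x| ≤ (2 / M : ℝ) ^ n := by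
    intro n
    induction n with
    | zero => intro x; simpa using (hG 0).abs_sub_le (hG 1) x x
    | succ n ih =>
      intro x
      rw [hGs n, hGs (n + 1), pow_succ']
      exact abs_refine_sub_refine_le hM hK.pos (hG n) (hG (n + 1)) ih x
  have hlim : ∀ x, ∃ l, Filter.Tendsto (fun n => G n x) Filter.atTop (nhds l) := fun x =>
    cauchySeq_tendsto_of_complete (cauchySeq_of_le_geometric (2 / M : ℝ) 1 hM2 fun n => by
      rw [Real.dist_eq, one_mul]; exact hC n x)
  choose g hg using hlim
  refine ⟨g, ⟨fun x hx => ?_, fun x hx => ?_, fun x => ?_, fun x => ?_⟩, fun x y => ?_,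
    fun i hi y hy => ?_⟩
  · exact tendsto_nhds_unique (hg x) (by simp [(hG _).left x hx])
  · exact tendsto_nhds_unique (hg x) (by simp [(hG _).right x hx])
  · exact ge_of_tendsto' (hg x) fun n => (hG n).nonneg x
  · exact le_of_tendsto' (hg x) fun n => (hG n).le_one x
  · exact le_of_tendsto' ((hg x).sub (hg y)).abs fun n => hH n x y
  · refine tendsto_nhds_unique ((Filter.tendsto_add_atTop_iff_nat 1).mpr (hg _)) ?_
    simp only [hGs, refine_center hN (hG _) hi hy]
    have hc : Continuous fold := by unfold fold; fun_prop
    exact (hc.tendsto _).comp (((hg y).const_add _).div_const _)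

/-! ### Finite fractional energy of Hölder functions -/

section FiniteEnergy

/-- A function `k` on a finite-dimensional space that is `O(‖z‖ ^ (γ - D))` near `0` and
`O(‖z‖ ^ (-D - δ))` at infinity, where `D` is the dimension, has a finite integral. -/
lemma lintegral_radial_lt_top {E : Type*} [NormedAddCommGroup E] [NormedSpace ℝ E]
    [FiniteDimensional ℝ E] [MeasurableSpace E] [BorelSpace E] (μ : Measure E)
    [μ.IsAddHaarMeasure] (hE : 1 ≤ Module.finrank ℝ E) {γ δ : ℝ} (hγ : 0 < γ) (hδ : 0 < δ)
    (A B : ℝ) :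
    ∫⁻ z : E, ENNReal.ofReal (if ‖z‖ < 1 then A * ‖z‖ ^ (-((Module.finrank ℝ E : ℝ) - γ))
      else B * ‖z‖ ^ (-((Module.finrank ℝ E : ℝ) + δ))) ∂μ < ⊤ := by
  set D : ℝ := (Module.finrank ℝ E : ℝ) with hD
  have hm : ∀ e : ℝ, Measurable fun z : E => ‖z‖ ^ e := fun e => by fun_prop
  have h1 : IntegrableOn (fun z : E => A * ‖z‖ ^ (-(D - γ))) (Metric.ball 0 1) μ := by
    refine Integrable.const_mul ?_ A
    refine integrableOn_ball_of_norm_le_rpow hE (C := 1) (α := D - γ) (by linarith) ?_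
      (hm _).aestronglyMeasurable
    refine Filter.Eventually.of_forall fun z => ?_
    rw [Real.norm_of_nonneg (by positivity), one_mul]
  have h2 : Integrable (fun z : E => |B| * (2 ^ (D + δ) * (1 + ‖z‖) ^ (-(D + δ)))) μ :=
    ((integrable_one_add_norm (by linarith)).const_mul _).const_mul _
  have h3 : Integrable (fun z : E => (Metric.ball (0 : E) 1).indicator
      (fun z : E => A * ‖z‖ ^ (-(D - γ))) z
      + |B| * (2 ^ (D + δ) * (1 + ‖z‖) ^ (-(D + δ)))) μ :=
    (h1.integrable_indicator Metric.isOpen_ball.measurableSet).add h2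
  refine lt_of_le_of_lt (lintegral_mono fun z => ?_)
    (lt_of_le_of_lt (lintegral_ofReal_le_lintegral_enorm _) h3.2)
  apply ENNReal.ofReal_le_ofReal
  by_cases hz : ‖z‖ < 1
  · rw [if_pos hz, Set.indicator_of_mem (by simpa using hz)]
    exact le_add_of_nonneg_right (by positivity)
  · rw [if_neg hz, Set.indicator_of_notMem (by simpa using hz), zero_add]
    push Not at hz
    have h4 : ‖z‖ ^ (-(D + δ)) ≤ 2 ^ (D + δ) * (1 + ‖z‖) ^ (-(D + δ)) := by
      have hp : 0 < D + δ := by positivity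
      rw [Real.rpow_neg (by positivity), Real.rpow_neg (by positivity), ← div_eq_mul_inv,
        inv_eq_one_div, div_le_div_iff₀ (by positivity) (by positivity), one_mul,
        ← Real.mul_rpow (by positivity) (by positivity)]
      exact Real.rpow_le_rpow (by positivity) (by linarith) hp.le
    calc B * ‖z‖ ^ (-(D + δ)) ≤ |B| * ‖z‖ ^ (-(D + δ)) := by
          gcongr
          exact le_abs_self B
      _ ≤ _ := by gcongr

/-- Bounded `σ`-Hölder functions vanishing outside a ball have finite fractional phase of every
order `s < σ` and every exponent, for every bounded weight. -/
theorem phase_lt_top {n : ℕ} {s σ p C M r : ℝ} (hs : 0 < s) (hsσ : s < σ) (hp : 0 < p)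
    {f : EuclideanSpace ℝ (Fin (n + 1)) → ℝ}
    (hf : ∀ x y, |f x - f y| ≤ C * ‖x - y‖ ^ σ) (hfb : ∀ x, |f x| ≤ C)
    (hf0 : ∀ x, r ≤ ‖x‖ → f x = 0)
    {b : EuclideanSpace ℝ (Fin (n + 1)) → EuclideanSpace ℝ (Fin (n + 1)) → ℝ}
    (hbM : ∀ x y, b x y ≤ M) :
    phase (n + 1) s p b f < ⊤ := by
  have hC : 0 ≤ C := (abs_nonneg _).trans (hfb 0)
  have hfin : (Module.finrank ℝ (EuclideanSpace ℝ (Fin (n + 1))) : ℝ) = ((n + 1 : ℕ) : ℝ) := by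
    simp
  set D : ℝ := ((n + 1 : ℕ) : ℝ) with hD
  have hD0 : 0 < D := by positivity
  let k : EuclideanSpace ℝ (Fin (n + 1)) → ENNReal := fun z =>
    ENNReal.ofReal (if ‖z‖ < 1 then (1 / p * (|M| * C ^ p)) * ‖z‖ ^ (-(D - (σ - s) * p))
      else (1 / p * (|M| * (2 * C) ^ p)) * ‖z‖ ^ (-(D + s * p)))
  have hk : Measurable k := by
    refine Measurable.ennreal_ofReal (Measurable.ite ?_ (by fun_prop) (by fun_prop))
    exact measurableSet_lt (by fun_prop) (by fun_prop)
  have hkt : ∫⁻ z, k z < ⊤ := by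
    have := lintegral_radial_lt_top (E := EuclideanSpace ℝ (Fin (n + 1))) volume (by simp)
      (γ := (σ - s) * p) (δ := s * p) (mul_pos (by linarith) hp) (mul_pos hs hp)
      (1 / p * (|M| * C ^ p)) (1 / p * (|M| * (2 * C) ^ p))
    rw [hfin] at this
    exact this
  let χ : EuclideanSpace ℝ (Fin (n + 1)) → ENNReal := (Metric.ball 0 r).indicator 1
  have hχ : Measurable χ := measurable_one.indicator Metric.isOpen_ball.measurableSet
  have hχi : ∫⁻ x, χ x < ⊤ := by
    simp only [χ]
    rw [lintegral_indicator_one Metric.isOpen_ball.measurableSet]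
    exact measure_ball_lt_top
  -- the integrand vanishes unless one of the two points lies in the ball
  have hpt : ∀ x y, ENNReal.ofReal (1 / p * (b x y * (|f x - f y| ^ p / ‖x - y‖ ^ (D + s * p))))
      ≤ χ x * k (x - y) + χ y * k (x - y) := by
    intro x y
    by_cases hxy : f x - f y = 0
    · simp [hxy, Real.zero_rpow hp.ne']
    have hne : 0 < ‖x - y‖ := by
      rw [norm_pos_iff, sub_ne_zero]
      rintro rfl
      exact hxy (sub_self _)
    have h1 : ENNReal.ofReal (1 / p * (b x y * (|f x - f y| ^ p / ‖x - y‖ ^ (D + s * p))))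
        ≤ k (x - y) := by
      apply ENNReal.ofReal_le_ofReal
      have hbM' : b x y ≤ |M| := (hbM x y).trans (le_abs_self M)
      split_ifs with h
      · have e : C ^ p * ‖x - y‖ ^ (-(D - (σ - s) * p))
            = (C * ‖x - y‖ ^ σ) ^ p / ‖x - y‖ ^ (D + s * p) := by
          rw [Real.mul_rpow hC (by positivity), ← Real.rpow_mul hne.le, mul_div_assoc,
            ← Real.rpow_sub hne]
          congr 2
          ring
        rw [mul_assoc, mul_assoc, e]
        have := hf x y
        gcongr
      · have e : (2 * C) ^ p * ‖x - y‖ ^ (-(D + s * p))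
            = (2 * C) ^ p / ‖x - y‖ ^ (D + s * p) := by
          rw [Real.rpow_neg hne.le, div_eq_mul_inv]
        rw [mul_assoc, mul_assoc, e]
        have : |f x - f y| ≤ 2 * C := by
          have h1 := abs_le.mp (hfb x)
          have h2 := abs_le.mp (hfb y)
          rw [abs_le]
          constructor <;> linarith
        gcongr
    by_cases hx : ‖x‖ < r
    · have : χ x = 1 := by simp [χ, hx]
      rw [this, one_mul]
      exact h1.trans le_self_add
    · have hy : ‖y‖ < r := by
        by_contra hy
        exact hxy (by rw [hf0 x (not_lt.mp hx), hf0 y (not_lt.mp hy), sub_self])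
      have : χ y = 1 := by simp [χ, hy]
      rw [this, one_mul]
      exact h1.trans le_add_self
  have hkm : Measurable fun z : EuclideanSpace ℝ (Fin (n + 1)) × EuclideanSpace ℝ (Fin (n + 1)) =>
      k (z.1 - z.2) := hk.comp (measurable_fst.sub measurable_snd)
  have hkl : ∀ x, Measurable fun y => k (x - y) := fun x => hk.comp (measurable_id.const_sub x)
  have hkr : ∀ y, Measurable fun x => k (x - y) := fun y => hk.comp (measurable_id.sub_const y)
  calc phase (n + 1) s p b f
      ≤ ∫⁻ x, ∫⁻ y, (χ x * k (x - y) + χ y * k (x - y)) :=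
        lintegral_mono fun x => lintegral_mono fun y => hpt x y
    _ = ∫⁻ x, ((∫⁻ y, χ x * k (x - y)) + ∫⁻ y, χ y * k (x - y)) := by
        congr with x
        rw [lintegral_add_left ((hkl x).const_mul _)]
    _ = (∫⁻ x, ∫⁻ y, χ x * k (x - y)) + ∫⁻ x, ∫⁻ y, χ y * k (x - y) := by
        exact lintegral_add_left
          (Measurable.lintegral_prod_right' ((hχ.comp measurable_fst).mul hkm)) _
    _ = (∫⁻ x, χ x) * (∫⁻ z, k z) + (∫⁻ x, χ x) * ∫⁻ z, k z := by
        congr 1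
        · rw [← lintegral_mul_const _ hχ]
          congr with x
          rw [lintegral_const_mul _ (hkl x),
            lintegral_sub_left_eq_self k x]
        · rw [lintegral_lintegral_swap ((hχ.comp measurable_snd).mul hkm).aemeasurable,
            ← lintegral_mul_const _ hχ]
          congr with y
          rw [lintegral_const_mul _ (hkr y),
            lintegral_sub_right_eq_self k y]
    _ < ⊤ := ENNReal.add_lt_top.mpr ⟨ENNReal.mul_lt_top hχi hkt, ENNReal.mul_lt_top hχi hkt⟩

end FiniteEnergy

/-! ### The self-similar geometry and the weight -/

section Geometry

/-- The ambient space `ℝ^(n+1)`; the coordinate `0` is the direction in which the staircase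
rises. -/
abbrev Space (n : ℕ) := EuclideanSpace ℝ (Fin (n + 1))

/-- The box `(-2, 2) × (0, 1/(n+1))^n`. -/
def box (n : ℕ) : Set (Space n) :=
  {x | |x 0| < 2 ∧ ∀ l : Fin n, 0 < x l.succ ∧ x l.succ < ((n : ℝ) + 1)⁻¹}

/-- Indices of the children of the box: one of `N` intervals in the direction of coordinate `0`
and one of the `4 * N` subdivisions in each of the other directions. -/
abbrev Child (n N : ℕ) := Fin N × (Fin n → Fin (4 * N))

/-- The translation part of `sub N i`. -/
noncomputable def shift {n : ℕ} (N : ℕ) (i : Child n N) : Space n :=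
  WithLp.toLp 2 (Fin.cons (center N i.1) fun l => ((n : ℝ) + 1)⁻¹ * (i.2 l : ℕ) / (4 * N))

/-- The similarity of ratio `1 / (4 * N)` that maps `box n` onto its child of index `i`. It never
reverses the orientation: on a descending traverse the two ends of the child swap roles instead. -/
noncomputable def sub {n : ℕ} (N : ℕ) (i : Child n N) (x : Space n) : Space n :=
  (4 * N : ℝ)⁻¹ • x + shift N i

variable {n N : ℕ}

lemma sub_apply_zero (i : Child n N) (x : Space n) :
    sub N i x 0 = x 0 / (4 * N) + center N i.1 := by
  simp [sub, shift, div_eq_inv_mul]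

lemma sub_apply_succ (i : Child n N) (x : Space n) (l : Fin n) :
    sub N i x l.succ = (x l.succ + ((n : ℝ) + 1)⁻¹ * (i.2 l : ℕ)) / (4 * N) := by
  simp only [sub, shift, PiLp.add_apply, PiLp.smul_apply, Fin.cons_succ, smul_eq_mul]
  ring

lemma norm_sub_sub (i : Child n N) (x y : Space n) :
    ‖sub N i x - sub N i y‖ = (4 * N : ℝ)⁻¹ * ‖x - y‖ := by
  rw [sub, sub, add_sub_add_right_eq_sub, ← smul_sub, norm_smul,
    Real.norm_of_nonneg (by positivity)]

lemma isOpen_box : IsOpen (box n) := by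
  have : box n = {x : Space n | |x 0| < 2} ∩
      ⋂ l : Fin n, {x : Space n | 0 < x l.succ ∧ x l.succ < ((n : ℝ) + 1)⁻¹} := by
    ext x; simp [box]
  rw [this]
  have hc : ∀ l : Fin (n + 1), Continuous fun x : Space n => x l := fun l => by fun_prop
  refine (isOpen_lt (hc 0).abs continuous_const).inter (isOpen_iInter_of_finite fun l => ?_)
  exact (isOpen_lt continuous_const (hc _)).inter (isOpen_lt (hc _) continuous_const)

lemma norm_sq_lt_of_mem_box {x : Space n} (hx : x ∈ box n) : ‖x‖ ^ 2 ≤ x 0 ^ 2 + 1 / 4 := by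
  rw [EuclideanSpace.norm_sq_eq, Fin.sum_univ_succ]
  simp only [Real.norm_eq_abs, sq_abs]
  gcongr
  calc ∑ l : Fin n, x l.succ ^ 2 ≤ ∑ _l : Fin n, (((n : ℝ) + 1)⁻¹) ^ 2 := by
        refine Finset.sum_le_sum fun l _ => ?_
        have := hx.2 l
        gcongr
        · exact this.1.le
        · exact this.2.le
    _ = n / ((n : ℝ) + 1) ^ 2 := by
        simp [div_eq_mul_inv]
    _ ≤ 1 / 4 := by
        rw [div_le_div_iff₀ (by positivity) (by norm_num)]
        nlinarith [sq_nonneg ((n : ℝ) - 1)]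

lemma norm_lt_of_mem_box {x : Space n} (hx : x ∈ box n) : ‖x‖ < 5 / 2 := by
  have h1 := norm_sq_lt_of_mem_box hx
  have h2 : x 0 ^ 2 < 4 := by
    have := abs_lt.mp hx.1
    nlinarith
  nlinarith [norm_nonneg x]

lemma sub_mem_box {i : Child n N} {x : Space n} (hx : x ∈ box n) :
    sub N i x ∈ box n := by
  have hN : 0 < N := (Nat.zero_le _).trans_lt i.1.2
  have hN' : (0 : ℝ) < N := by positivity
  constructor
  · rw [sub_apply_zero]
    have h1 := abs_lt.mp hx.1
    have h2 : (i.1 : ℝ) + 1 ≤ N := by exact_mod_cast i.1.2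
    have h3 : (0 : ℝ) ≤ (i.1 : ℕ) := by positivity
    have e : x 0 / (4 * N) + center N i.1 = (x 0 + 4 * (i.1 : ℕ) + 2) / (4 * N) - 1 / 2 := by
      unfold center; ring
    rw [e, abs_lt]
    constructor
    · have : 0 < (x 0 + 4 * (i.1 : ℕ) + 2) / (4 * N) := by
        apply div_pos <;> linarith
      linarith
    · have : (x 0 + 4 * (i.1 : ℕ) + 2) / (4 * N) ≤ 1 := by
        rw [div_le_one (by positivity)]; linarith
      linarith
  · intro l
    rw [sub_apply_succ]
    have h1 := hx.2 l
    have h2 : ((i.2 l : ℕ) : ℝ) + 1 ≤ 4 * N := by exact_mod_cast (i.2 l).2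
    have hc : (0 : ℝ) < ((n : ℝ) + 1)⁻¹ := by positivity
    constructor
    · exact div_pos (add_pos_of_pos_of_nonneg h1.1 (by positivity)) (by positivity)
    · rw [div_lt_iff₀ (by positivity)]
      nlinarith

/-- Different children of the box are disjoint. -/
lemma eq_of_sub_eq_sub {i j : Child n N} {x y : Space n} (hx : x ∈ box n) (hy : y ∈ box n)
    (h : sub N i x = sub N j y) : i = j := by
  have hN : 0 < N := (Nat.zero_le _).trans_lt i.1.2
  have hN' : (0 : ℝ) < N := by positivity
  have key : ∀ a b : ℕ, (a : ℝ) < b + 1 → (b : ℝ) < a + 1 → a = b := by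
    intro a b h1 h2
    have h1' : a < b + 1 := by exact_mod_cast h1
    have h2' : b < a + 1 := by exact_mod_cast h2
    omega
  have h0 : (i.1 : ℕ) = j.1 := by
    have h1 := congrArg (fun z : Space n => z 0) h
    simp only [sub_apply_zero, center] at h1
    field_simp at h1
    have hx' := abs_lt.mp hx.1
    have hy' := abs_lt.mp hy.1
    apply key <;> linarith
  refine Prod.ext (Fin.ext h0) (funext fun l => Fin.ext ?_)
  have h1 := congrArg (fun z : Space n => z l.succ) h
  simp only [sub_apply_succ] at h1
  rw [div_left_inj' (by positivity)] at h1
  have hx' := hx.2 l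
  have hy' := hy.2 l
  have hc : (0 : ℝ) < ((n : ℝ) + 1)⁻¹ := by positivity
  apply key
  · refine lt_of_mul_lt_mul_left (a := ((n : ℝ) + 1)⁻¹) ?_ hc.le
    linarith
  · refine lt_of_mul_lt_mul_left (a := ((n : ℝ) + 1)⁻¹) ?_ hc.le
    linarith

lemma lintegral_comp_smul_add {r : ℝ} (hr : 0 < r) (b : Space n) (f : Space n → ENNReal) :
    ∫⁻ x, f (r⁻¹ • x + b) = ENNReal.ofReal (r ^ (n + 1)) * ∫⁻ x, f x := by
  have hr' : r⁻¹ ≠ 0 := inv_ne_zero hr.ne'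
  have h1 := lintegral_map_equiv (μ := (volume : Measure (Space n))) (fun x => f (x + b))
    (Homeomorph.smul (isUnit_iff_ne_zero.2 hr').unit).toMeasurableEquiv
  have h2 : Measure.map (⇑(Homeomorph.smul (isUnit_iff_ne_zero.2 hr').unit).toMeasurableEquiv)
      (volume : Measure (Space n)) = ENNReal.ofReal (r ^ (n + 1)) • volume := by
    have := Measure.map_addHaar_smul (volume : Measure (Space n)) hr'
    simp only [finrank_euclideanSpace, Fintype.card_fin, inv_pow, inv_inv] at this
    rw [abs_of_pos (by positivity)] at this
    exact this
  rw [h2, lintegral_smul_measure, lintegral_add_right_eq_self] at h1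
  exact h1.symm

lemma lintegral_comp_sub (hN : 0 < N) (i : Child n N) (f : Space n → ENNReal) :
    ∫⁻ x, f (sub N i x) = ENNReal.ofReal ((4 * N : ℝ) ^ (n + 1)) * ∫⁻ x, f x :=
  lintegral_comp_smul_add (by positivity) _ f

lemma isOpen_image_sub (hN : 0 < N) (i : Child n N) : IsOpen (sub N i '' box n) := by
  have hr : (4 * N : ℝ)⁻¹ ≠ 0 := by positivity
  exact ((Homeomorph.smulOfNeZero _ hr).trans (Homeomorph.addRight (shift N i))).isOpenMap _
    isOpen_box

end Geometry

section Weight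

variable {n N : ℕ} {g : ℝ → ℝ}

/-- The part of the box where the function `x ↦ g (x 0)` is locally constant. -/
def flatSet (n : ℕ) (g : ℝ → ℝ) : Set (Space n) :=
  {x | x ∈ box n ∧ ∀ᶠ y in nhds x, g (y 0) = g (x 0)}

/-- The distance to the complement of `flatSet n g`. -/
noncomputable def depth (g : ℝ → ℝ) (x : Space n) : ℝ := Metric.infDist x (flatSet n g)ᶜ

open Classical in
/-- The weight: it charges pairs of points of the flat set at which the staircase takes the same
value, and decays like the power `α` of the distance to the complement of the flat set. -/
noncomputable def weight (g : ℝ → ℝ) (α : ℝ) (x y : Space n) : ℝ :=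
  if g (x 0) = g (y 0) then min (depth g x) (depth g y) ^ α else 0

lemma depth_nonneg (x : Space n) : 0 ≤ depth g x := Metric.infDist_nonneg

lemma single_notMem_flatSet (x : Space n) (hx : x ∈ box n) :
    x + EuclideanSpace.single 0 4 ∈ (flatSet n g)ᶜ := by
  intro h
  have h1 := abs_lt.mp h.1.1
  have h2 := abs_lt.mp hx.1
  simp only [PiLp.add_apply, PiLp.single_apply, if_true] at h1
  linarith

lemma flatSet_compl_nonempty : (flatSet n g)ᶜ.Nonempty := by
  by_cases h : (0 : Space n) ∈ box n
  · exact ⟨_, single_notMem_flatSet 0 h⟩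
  · exact ⟨0, fun h' => h h'.1⟩

lemma depth_eq_zero {x : Space n} (hx : x ∉ flatSet n g) : depth g x = 0 :=
  Metric.infDist_zero_of_mem hx

lemma depth_le_four (x : Space n) : depth g x ≤ 4 := by
  by_cases hx : x ∈ box n
  · refine (Metric.infDist_le_dist_of_mem (single_notMem_flatSet x hx)).trans ?_
    simp
  · rw [depth_eq_zero fun h => hx h.1]
    norm_num

lemma mem_flatSet_of_dist_lt {x y : Space n} (h : dist x y < depth g x) : y ∈ flatSet n g := by
  by_contra hy
  exact Metric.notMem_of_dist_lt_infDist h hy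

lemma isOpen_flatSet : IsOpen (flatSet n g) := by
  rw [isOpen_iff_mem_nhds]
  intro x hx
  filter_upwards [isOpen_box.mem_nhds hx.1, hx.2.eventually_nhds, hx.2] with y hy hy' hyx
  refine ⟨hy, ?_⟩
  rwa [hyx]

/-- The staircase is constant on every ball contained in the flat set. -/
lemma eq_of_dist_lt_depth {x y : Space n} (h : dist x y < depth g x) : g (y 0) = g (x 0) := by
  have hball : ∀ z ∈ Metric.ball x (depth g x), z ∈ flatSet n g := fun z hz =>
    mem_flatSet_of_dist_lt (by rwa [dist_comm])
  have hpre : IsPreconnected (Metric.ball x (depth g x)) := (convex_ball x _).isPreconnected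
  have hopen : ∀ P : ℝ → Prop, IsOpen {z : Space n | z ∈ flatSet n g ∧ P (g (z 0))} := by
    intro P
    rw [isOpen_iff_mem_nhds]
    rintro z ⟨hz, hP⟩
    filter_upwards [isOpen_flatSet.mem_nhds hz, hz.2] with w hw hwz
    exact ⟨hw, by rwa [hwz]⟩
  have hsub := hpre.subset_left_of_subset_union (hopen (· = g (x 0))) (hopen (· ≠ g (x 0)))
    (Set.disjoint_left.mpr fun z hz hz' => hz'.2 hz.2)
    (fun z hz => (em (g (z 0) = g (x 0))).imp (fun e => ⟨hball z hz, e⟩)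
      fun e => ⟨hball z hz, e⟩)
    ⟨x, Metric.mem_ball_self (dist_nonneg.trans_lt h), hball x
      (Metric.mem_ball_self (dist_nonneg.trans_lt h)), rfl⟩
  exact (hsub (Metric.mem_ball'.mpr h)).2

lemma le_depth {x : Space n} {ρ : ℝ} (h : ∀ y, dist x y < ρ → y ∈ flatSet n g) :
    ρ ≤ depth g x := by
  refine (Metric.le_infDist flatSet_compl_nonempty).mpr fun y hy => ?_
  by_contra hc
  exact hy (h y (not_le.mp hc))

lemma weight_nonneg (α : ℝ) (x y : Space n) : 0 ≤ weight g α x y := by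
  unfold weight
  split_ifs
  · exact Real.rpow_nonneg (le_min (depth_nonneg x) (depth_nonneg y)) _
  · exact le_rfl

lemma weight_comm (α : ℝ) (x y : Space n) : weight g α x y = weight g α y x := by
  unfold weight
  rw [min_comm]
  simp only [eq_comm]

lemma weight_le {α : ℝ} (hα : 0 < α) (x y : Space n) : weight g α x y ≤ 4 ^ α := by
  unfold weight
  split_ifs
  · exact Real.rpow_le_rpow (le_min (depth_nonneg x) (depth_nonneg y))
      ((min_le_left _ _).trans (depth_le_four x)) hα.le
  · positivity

lemma weight_eq_zero {α : ℝ} (hα : 0 < α) {x y : Space n}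
    (h : x ∉ flatSet n g ∨ y ∉ flatSet n g ∨ g (x 0) ≠ g (y 0)) : weight g α x y = 0 := by
  unfold weight
  split_ifs with he
  · have : min (depth g x) (depth g y) = 0 := by
      rcases h with h | h | h
      · rw [depth_eq_zero h]; exact min_eq_left (depth_nonneg y)
      · rw [depth_eq_zero h]; exact min_eq_right (depth_nonneg x)
      · exact absurd he h
    rw [this, Real.zero_rpow hα.ne']
  · rfl

lemma abs_depth_sub_le (x y : Space n) : |depth g x - depth g y| ≤ dist x y := by
  have := (Metric.lipschitz_infDist_pt (flatSet n g)ᶜ).dist_le_mul x y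
  simpa [Real.dist_eq, depth] using this

/-- A displacement smaller than the depth of the points does not change the values of the
staircase, and a larger one exceeds the weight itself. -/
lemma weight_sub_weight_le {α : ℝ} (hα : 0 < α) (hα1 : α ≤ 1) (x y x' y' : Space n) :
    weight g α x y - weight g α x' y' ≤ max (dist x x') (dist y y') ^ α := by
  set r := max (dist x x') (dist y y') with hr
  have hr0 : 0 ≤ r := le_max_of_le_left dist_nonneg
  have hd : 0 ≤ min (depth g x) (depth g y) := le_min (depth_nonneg x) (depth_nonneg y)
  have hd' : 0 ≤ min (depth g x') (depth g y') := le_min (depth_nonneg x') (depth_nonneg y')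
  have hw := weight_nonneg (g := g) α x' y'
  by_cases he : g (x 0) = g (y 0)
  swap
  · rw [weight, if_neg he]
    have := Real.rpow_nonneg hr0 α
    linarith
  by_cases hlt : r < min (depth g x) (depth g y)
  · have hx := eq_of_dist_lt_depth (g := g) (x := x) (y := x')
      ((le_max_left _ _).trans_lt (hlt.trans_le (min_le_left _ _)))
    have hy := eq_of_dist_lt_depth (g := g) (x := y) (y := y')
      ((le_max_right _ _).trans_lt (hlt.trans_le (min_le_right _ _)))
    rw [weight, weight, if_pos he, if_pos (by rw [hx, hy, he])]
    have h1 : min (depth g x) (depth g y) ≤ min (depth g x') (depth g y') + r := by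
      have := (abs_min_sub_min_le_max (depth g x) (depth g y) (depth g x') (depth g y')).trans
        (max_le_max (abs_depth_sub_le x x') (abs_depth_sub_le y y'))
      linarith [(abs_le.mp this).2]
    have h2 := (Real.rpow_le_rpow hd h1 hα.le).trans (Real.rpow_add_le_add_rpow hd' hr0 hα.le hα1)
    linarith
  · push Not at hlt
    have : weight g α x y ≤ r ^ α := by
      rw [weight, if_pos he]
      exact Real.rpow_le_rpow hd hlt hα.le
    linarith

lemma holderWith_weight {α : NNReal} (hα : 0 < α) (hα1 : α ≤ 1) :
    HolderWith 1 α (fun z : Space n × Space n => weight g α z.1 z.2) := by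
  intro z z'
  have hα' : (0 : ℝ) < α := by exact_mod_cast hα
  have hα1' : (α : ℝ) ≤ 1 := by exact_mod_cast hα1
  rw [ENNReal.coe_one, one_mul, edist_dist, edist_dist,
    ENNReal.ofReal_rpow_of_nonneg dist_nonneg hα'.le]
  apply ENNReal.ofReal_le_ofReal
  rw [Real.dist_eq, abs_le, Prod.dist_eq]
  have h1 := weight_sub_weight_le (g := g) hα' hα1' z.1 z.2 z'.1 z'.2
  have h2 := weight_sub_weight_le (g := g) hα' hα1' z'.1 z'.2 z.1 z.2
  rw [dist_comm z'.1, dist_comm z'.2] at h2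
  constructor <;> linarith

/-- The staircase takes equal values at the images of two points under a similarity `sub N i` if
it takes equal values at the points. -/
def RespectsChildren (N : ℕ) (g : ℝ → ℝ) : Prop :=
  ∀ i < N, ∀ y z : ℝ, |y| ≤ 2 → |z| ≤ 2 → g y = g z →
    g (y / (4 * N) + center N i) = g (z / (4 * N) + center N i)

lemma sub_mem_flatSet (hN : 0 < N) (hg : RespectsChildren N g) (i : Child n N) {x : Space n}
    (hx : x ∈ flatSet n g) : sub N i x ∈ flatSet n g := by
  refine ⟨sub_mem_box hx.1, ?_⟩
  have hr : (4 * N : ℝ)⁻¹ ≠ 0 := by positivity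
  let Φ := (Homeomorph.smulOfNeZero _ hr).trans (Homeomorph.addRight (shift N i))
  have hΦ : ∀ z, Φ z = sub N i z := fun z => rfl
  rw [← hΦ, ← Φ.map_nhds_eq, Filter.eventually_map]
  filter_upwards [hx.2, isOpen_box.mem_nhds hx.1] with z hz hzb
  rw [hΦ, hΦ, sub_apply_zero, sub_apply_zero]
  exact hg _ i.1.2 _ _ hzb.1.le hx.1.1.le hz

lemma depth_le_depth_sub (hN : 0 < N) (hg : RespectsChildren N g) (i : Child n N) (x : Space n) :
    (4 * N : ℝ)⁻¹ * depth g x ≤ depth g (sub N i x) := by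
  have hr : (4 * N : ℝ)⁻¹ ≠ 0 := by positivity
  apply le_depth
  intro y hy
  obtain ⟨z, rfl⟩ : ∃ z, sub N i z = y :=
    ((Homeomorph.smulOfNeZero _ hr).trans (Homeomorph.addRight (shift N i))).surjective y
  rw [dist_eq_norm, norm_sub_sub, ← dist_eq_norm] at hy
  exact sub_mem_flatSet hN hg i (mem_flatSet_of_dist_lt (lt_of_mul_lt_mul_left hy (by positivity)))

lemma weight_le_weight_sub (hN : 0 < N) (hg : RespectsChildren N g) {α : ℝ} (hα : 0 < α)
    (i : Child n N) (x y : Space n) :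
    weight g α x y ≤ (4 * N : ℝ) ^ α * weight g α (sub N i x) (sub N i y) := by
  have hR : (0 : ℝ) < 4 * N := by positivity
  have hnn : 0 ≤ (4 * N : ℝ) ^ α * weight g α (sub N i x) (sub N i y) :=
    mul_nonneg (by positivity) (weight_nonneg _ _ _)
  by_cases h : x ∉ flatSet n g ∨ y ∉ flatSet n g ∨ g (x 0) ≠ g (y 0)
  · rwa [weight_eq_zero hα h]
  push Not at h
  obtain ⟨hx, hy, he⟩ := h
  have he' : g (sub N i x 0) = g (sub N i y 0) := by
    rw [sub_apply_zero, sub_apply_zero]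
    exact hg _ i.1.2 _ _ hx.1.1.le hy.1.1.le he
  rw [weight, weight, if_pos he, if_pos he', ← Real.mul_rpow hR.le
    (le_min (depth_nonneg _) (depth_nonneg _))]
  refine Real.rpow_le_rpow (le_min (depth_nonneg x) (depth_nonneg y)) ?_ hα.le
  rw [← inv_mul_le_iff₀ hR, mul_min_of_nonneg _ _ (by positivity)]
  exact min_le_min (depth_le_depth_sub hN hg i x) (depth_le_depth_sub hN hg i y)

/-- Scaling of the weighted phase: the energies of the rescalings of `v` to the children add up
to at most `(4 * N) ^ (d - t q + α)` times the energy of `v`. -/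
theorem sum_phase_comp_sub_le (hN : 0 < N) (hg : RespectsChildren N g) {α t q : ℝ} (hα : 0 < α)
    (hq : 0 < q) (v : Space n → ℝ) :
    ∑ i : Child n N, phase (n + 1) t q (weight g α) (v ∘ sub N i) ≤
      ENNReal.ofReal ((4 * N : ℝ) ^ (((n + 1 : ℕ) : ℝ) - t * q + α)) *
        phase (n + 1) t q (weight g α) v := by
  have hR : (0 : ℝ) < 4 * N := by positivity
  set R : ℝ := 4 * N with hRdef
  set D : ℝ := ((n + 1 : ℕ) : ℝ) with hD
  let Ψ : Space n → Space n → ENNReal := fun x y => ENNReal.ofReal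
    (1 / q * (weight g α x y * (|v x - v y| ^ q / ‖x - y‖ ^ (D + t * q))))
  have hpt : ∀ (i : Child n N) (x y : Space n), ENNReal.ofReal
      (1 / q * (weight g α x y * (|v (sub N i x) - v (sub N i y)| ^ q / ‖x - y‖ ^ (D + t * q))))
      ≤ ENNReal.ofReal (R ^ (α - (D + t * q))) *
        (sub N i '' box n).indicator (fun x' => Ψ x' (sub N i y)) (sub N i x) := by
    intro i x y
    by_cases hx : x ∈ box n
    · rw [Set.indicator_of_mem (Set.mem_image_of_mem _ hx), ← ENNReal.ofReal_mul (by positivity)]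
      apply ENNReal.ofReal_le_ofReal
      rw [norm_sub_sub, ← hRdef, Real.mul_rpow (by positivity) (norm_nonneg _),
        Real.inv_rpow hR.le, Real.rpow_sub hR]
      have h1 := weight_le_weight_sub hN hg hα i x y
      rw [← hRdef] at h1
      calc 1 / q * (weight g α x y
            * (|v (sub N i x) - v (sub N i y)| ^ q / ‖x - y‖ ^ (D + t * q)))
          ≤ 1 / q * ((R ^ α * weight g α (sub N i x) (sub N i y))
            * (|v (sub N i x) - v (sub N i y)| ^ q / ‖x - y‖ ^ (D + t * q))) := by gcongr
        _ = _ := by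
          have : R ^ (D + t * q) ≠ 0 := by positivity
          rw [mul_comm (R ^ (D + t * q))⁻¹, ← div_eq_mul_inv, div_div_eq_mul_div]
          field_simp
    · rw [weight_eq_zero hα (Or.inl fun h => hx h.1)]
      simp
  have hone : ∀ i : Child n N, phase (n + 1) t q (weight g α) (v ∘ sub N i) ≤
      ENNReal.ofReal (R ^ (D - t * q + α)) * ∫⁻ x in sub N i '' box n, ∫⁻ y, Ψ x y := by
    intro i
    calc phase (n + 1) t q (weight g α) (v ∘ sub N i)
        ≤ ∫⁻ x, ∫⁻ y, ENNReal.ofReal (R ^ (α - (D + t * q))) *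
          (sub N i '' box n).indicator (fun x' => Ψ x' (sub N i y)) (sub N i x) :=
          lintegral_mono fun x => lintegral_mono fun y => hpt i x y
      _ = ∫⁻ x, ENNReal.ofReal (R ^ (α - (D + t * q))) * (ENNReal.ofReal (R ^ (n + 1)) *
          (sub N i '' box n).indicator (fun x' => ∫⁻ y, Ψ x' y) (sub N i x)) := by
          congr with x
          rw [lintegral_const_mul' _ _ ENNReal.ofReal_ne_top]
          congr 1
          by_cases hx : sub N i x ∈ sub N i '' box n
          · simp only [Set.indicator_of_mem hx]
            exact lintegral_comp_sub hN i _
          · simp only [Set.indicator_of_notMem hx]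
            simp
      _ = ENNReal.ofReal (R ^ (α - (D + t * q))) * (ENNReal.ofReal (R ^ (n + 1)) *
          (ENNReal.ofReal (R ^ (n + 1)) * ∫⁻ x in sub N i '' box n, ∫⁻ y, Ψ x y)) := by
          rw [lintegral_const_mul' _ _ ENNReal.ofReal_ne_top,
            lintegral_const_mul' _ _ ENNReal.ofReal_ne_top, lintegral_comp_sub hN i,
            lintegral_indicator (isOpen_image_sub hN i).measurableSet]
      _ = _ := by
          rw [← mul_assoc, ← mul_assoc, ← ENNReal.ofReal_mul (by positivity),
            ← ENNReal.ofReal_mul (by positivity), ← Real.rpow_natCast, ← Real.rpow_add hR,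
            ← Real.rpow_add hR]
          congr 3
          rw [← hD]; ring
  calc ∑ i : Child n N, phase (n + 1) t q (weight g α) (v ∘ sub N i)
      ≤ ∑ i : Child n N, ENNReal.ofReal (R ^ (D - t * q + α)) *
          ∫⁻ x in sub N i '' box n, ∫⁻ y, Ψ x y := Finset.sum_le_sum fun i _ => hone i
    _ = ENNReal.ofReal (R ^ (D - t * q + α)) *
          ∫⁻ x in ⋃ i : Child n N, sub N i '' box n, ∫⁻ y, Ψ x y := by
        rw [← Finset.mul_sum, lintegral_iUnion (fun i => (isOpen_image_sub hN i).measurableSet),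
          tsum_fintype]
        intro i j hij
        refine Set.disjoint_left.mpr ?_
        rintro _ ⟨x, hx, rfl⟩ ⟨y, hy, hxy⟩
        exact hij (eq_of_sub_eq_sub hx hy hxy.symm)
    _ ≤ _ := by
        exact mul_le_mul_right (setLIntegral_le_lintegral _ _) _

end Weight

/-! ### Averages over plates -/

section Plates

/-- An open box centred on the hyperplane `x 0 = a`; for `a = ± 3/2` it lies in the part of
`box n` where every step function is constant, at distance `1 / (4 (n+1))` from the boundary. -/
def plate (n : ℕ) (a : ℝ) : Set (Space n) :=
  {x | |x 0 - a| < 1 / 4 ∧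
    ∀ l : Fin n, ((n : ℝ) + 1)⁻¹ / 4 < x l.succ ∧ x l.succ < 3 * ((n : ℝ) + 1)⁻¹ / 4}

/-- The normalised volume on a plate. -/
noncomputable def plateMeasure (n : ℕ) (a : ℝ) : Measure (Space n) :=
  ProbabilityTheory.cond volume (plate n a)

/-- The difference of the averages of `v` over the right and the left plate. -/
noncomputable def drop {n : ℕ} (v : Space n → ℝ) : ℝ :=
  ∫ x, v x ∂plateMeasure n (3 / 2) - ∫ x, v x ∂plateMeasure n (-3 / 2)

variable {n N : ℕ} {g : ℝ → ℝ} {a a' : ℝ}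

lemma isOpen_plate : IsOpen (plate n a) := by
  have : plate n a = {x : Space n | |x 0 - a| < 1 / 4} ∩ ⋂ l : Fin n, {x : Space n |
      ((n : ℝ) + 1)⁻¹ / 4 < x l.succ ∧ x l.succ < 3 * ((n : ℝ) + 1)⁻¹ / 4} := by
    ext x; simp [plate]
  rw [this]
  have hc : ∀ l : Fin (n + 1), Continuous fun x : Space n => x l := fun l => by fun_prop
  refine (isOpen_lt ((hc 0).sub continuous_const).abs continuous_const).inter
    (isOpen_iInter_of_finite fun l => ?_)
  exact (isOpen_lt continuous_const (hc _)).inter (isOpen_lt (hc _) continuous_const)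

lemma plate_subset_box (ha : |a| = 3 / 2) : plate n a ⊆ box n := by
  intro x hx
  have h1 := abs_lt.mp hx.1
  have h2 := abs_le.mp ha.le
  have hc : (0 : ℝ) < ((n : ℝ) + 1)⁻¹ := by positivity
  refine ⟨abs_lt.mpr ⟨by linarith, by linarith⟩, fun l => ?_⟩
  have := hx.2 l
  constructor <;> linarith

lemma plate_nonempty : (plate n a).Nonempty := by
  refine ⟨WithLp.toLp 2 (Fin.cons a fun _ => ((n : ℝ) + 1)⁻¹ / 2), ?_, fun l => ?_⟩
  · simp
  · have hc : (0 : ℝ) < ((n : ℝ) + 1)⁻¹ := by positivity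
    simp only [Fin.cons_succ]
    constructor <;> linarith

lemma volume_plate_ne_zero : volume (plate n a) ≠ 0 :=
  (isOpen_plate.measure_pos _ plate_nonempty).ne'

lemma volume_plate_ne_top (ha : |a| = 3 / 2) : volume (plate n a) ≠ ⊤ := by
  have : plate n a ⊆ Metric.ball 0 (5 / 2) := fun x hx => by
    simpa using norm_lt_of_mem_box (plate_subset_box ha hx)
  exact ((measure_mono this).trans_lt measure_ball_lt_top).ne

lemma isProbabilityMeasure_plateMeasure (ha : |a| = 3 / 2) :
    IsProbabilityMeasure (plateMeasure n a) :=
  ProbabilityTheory.cond_isProbabilityMeasure_of_finite volume_plate_ne_zero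
    (volume_plate_ne_top ha)

lemma ae_plateMeasure : ∀ᵐ x ∂plateMeasure n a, x ∈ plate n a := by
  unfold plateMeasure ProbabilityTheory.cond
  exact Measure.ae_smul_measure (ae_restrict_mem isOpen_plate.measurableSet) _

lemma lintegral_plateMeasure_le (f : Space n → ENNReal) :
    ∫⁻ x, f x ∂plateMeasure n a ≤ (volume (plate n a))⁻¹ * ∫⁻ x, f x := by
  unfold plateMeasure ProbabilityTheory.cond
  rw [lintegral_smul_measure, smul_eq_mul]
  exact mul_le_mul_right (setLIntegral_le_lintegral _ _) _

/-- The balls of radius `1 / (4 (n+1))` about points of the plates lie in the flat set, because a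
step function is constant on either side of `[-1/2, 1/2]`. -/
lemma le_depth_of_mem_plate (hg : IsStep g) (ha : |a| = 3 / 2) {x : Space n}
    (hx : x ∈ plate n a) : ((n : ℝ) + 1)⁻¹ / 4 ≤ depth g x := by
  have hc : (0 : ℝ) < ((n : ℝ) + 1)⁻¹ := by positivity
  have hc1 : ((n : ℝ) + 1)⁻¹ ≤ 1 := inv_le_one_of_one_le₀ (by linarith [n.cast_nonneg (α := ℝ)])
  apply le_depth
  intro y hy
  have hcoord : ∀ l, |x l - y l| < ((n : ℝ) + 1)⁻¹ / 4 := by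
    intro l
    refine lt_of_le_of_lt ?_ hy
    have := PiLp.norm_apply_le (x - y) l
    rwa [PiLp.sub_apply, Real.norm_eq_abs, ← dist_eq_norm] at this
  have h0 := abs_lt.mp (hcoord 0)
  have hx0 := abs_lt.mp hx.1
  have hcont : Continuous fun z : Space n => z 0 := by fun_prop
  refine ⟨⟨?_, fun l => ?_⟩, ?_⟩
  · have h2 := abs_le.mp ha.le
    exact abs_lt.mpr ⟨by linarith, by linarith⟩
  · have h1 := abs_lt.mp (hcoord l.succ)
    have h2 := hx.2 l
    constructor <;> linarith
  · rcases eq_or_eq_neg_of_abs_eq ha with h | h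
    · filter_upwards [hcont.continuousAt.eventually_const_lt (show (1 / 2 : ℝ) < y 0 by linarith)]
        with z hz
      rw [hg.right _ hz.le, hg.right _ (by linarith)]
    · filter_upwards [hcont.continuousAt.eventually_lt_const (show y 0 < (-1 / 2 : ℝ) by linarith)]
        with z hz
      rw [hg.left _ hz.le, hg.left _ (by linarith)]

lemma integral_sub_integral_eq (ha : |a| = 3 / 2) (ha' : |a'| = 3 / 2) {v w : Space n → ℝ}
    (hv : Continuous v) (hw : Continuous w) {b : ℝ} (hvb : ∀ x, |v x| ≤ b)
    (hwb : ∀ x, |w x| ≤ b) :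
    ∫ x, v x ∂plateMeasure n a - ∫ x, w x ∂plateMeasure n a' =
      ∫ z, (v z.1 - w z.2) ∂(plateMeasure n a).prod (plateMeasure n a') := by
  have := isProbabilityMeasure_plateMeasure (n := n) ha
  have := isProbabilityMeasure_plateMeasure (n := n) ha'
  have h1 : Integrable v (plateMeasure n a) :=
    .of_bound hv.aestronglyMeasurable b (Filter.Eventually.of_forall hvb)
  have h2 : Integrable w (plateMeasure n a') :=
    .of_bound hw.aestronglyMeasurable b (Filter.Eventually.of_forall hwb)
  rw [integral_sub (h1.comp_fst _) (h2.comp_snd _), integral_fun_fst (fun x => v x),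
    integral_fun_snd (fun x => w x)]
  simp

/-- The averages of `v` over two plates, moved by maps `B` and `B'` that do not compress volume
too much, differ by at most a multiple of the energy if the weight is bounded below on the pairs
of image points. -/
lemma enorm_integral_sub_rpow_le {α t q w₀ : ℝ} (hq : 1 < q) (ht : 0 < t)
    (hw₀ : 0 < w₀) (ha : |a| = 3 / 2) (ha' : |a'| = 3 / 2) {κ : ENNReal} (hκ : κ ≠ ⊤)
    {B B' : Space n → Space n} (hB : Continuous B) (hB' : Continuous B')
    (hBκ : ∀ f : Space n → ENNReal, ∫⁻ x, f (B x) ≤ κ * ∫⁻ x, f x)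
    (hB'κ : ∀ f : Space n → ENNReal, ∫⁻ x, f (B' x) ≤ κ * ∫⁻ x, f x)
    (hbox : ∀ x ∈ plate n a, B x ∈ box n) (hbox' : ∀ x ∈ plate n a', B' x ∈ box n)
    (hw : ∀ x ∈ plate n a, ∀ y ∈ plate n a', w₀ ≤ weight g α (B x) (B' y))
    {v : Space n → ℝ} (hv : Continuous v) {b : ℝ} (hvb : ∀ x, |v x| ≤ b) :
    ‖∫ x, v (B x) ∂plateMeasure n a - ∫ x, v (B' x) ∂plateMeasure n a'‖ₑ ^ q ≤
      (ENNReal.ofReal (q * 5 ^ (((n + 1 : ℕ) : ℝ) + t * q) / w₀) *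
        ((volume (plate n a))⁻¹ * κ * ((volume (plate n a'))⁻¹ * κ))) *
        phase (n + 1) t q (weight g α) v := by
  have := isProbabilityMeasure_plateMeasure (n := n) ha
  have := isProbabilityMeasure_plateMeasure (n := n) ha'
  have hq0 : 0 < q := by linarith
  set D : ℝ := ((n + 1 : ℕ) : ℝ) with hD
  have hD0 : 0 < D := by positivity
  set μ := plateMeasure n a with hμ
  set μ' := plateMeasure n a' with hμ'
  let Ψ : Space n → Space n → ENNReal := fun x y => ENNReal.ofReal
    (1 / q * (weight g α x y * (|v x - v y| ^ q / ‖x - y‖ ^ (D + t * q))))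
  have hcont : Continuous fun z : Space n × Space n => v (B z.1) - v (B' z.2) := by fun_prop
  have hpt : ∀ x ∈ plate n a, ∀ y ∈ plate n a', ‖v (B x) - v (B' y)‖ₑ ^ q ≤
      ENNReal.ofReal (q * 5 ^ (D + t * q) / w₀) * Ψ (B x) (B' y) := by
    intro x hx y hy
    have hw' := hw x hx y hy
    rw [← ofReal_norm, ENNReal.ofReal_rpow_of_nonneg (norm_nonneg _) hq0.le,
      ← ENNReal.ofReal_mul (by positivity)]
    apply ENNReal.ofReal_le_ofReal
    rw [Real.norm_eq_abs]
    by_cases hne : B x = B' y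
    · simp [hne, Real.zero_rpow hq0.ne']
    have hpos : 0 < ‖B x - B' y‖ := norm_pos_iff.mpr (sub_ne_zero.mpr hne)
    have h5 : ‖B x - B' y‖ ≤ 5 := by
      have h1 := norm_lt_of_mem_box (hbox x hx)
      have h2 := norm_lt_of_mem_box (hbox' y hy)
      have := norm_sub_le (B x) (B' y)
      linarith
    set Δ := |v (B x) - v (B' y)| ^ q
    have hΔ : 0 ≤ Δ := by positivity
    calc Δ = (q * ‖B x - B' y‖ ^ (D + t * q) / w₀) *
          (1 / q * (w₀ * (Δ / ‖B x - B' y‖ ^ (D + t * q)))) := by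
          have : ‖B x - B' y‖ ^ (D + t * q) ≠ 0 := by positivity
          field_simp
      _ ≤ (q * 5 ^ (D + t * q) / w₀) *
          (1 / q * (weight g α (B x) (B' y) * (Δ / ‖B x - B' y‖ ^ (D + t * q)))) := by
          gcongr
  rw [integral_sub_integral_eq (v := fun x => v (B x)) (w := fun x => v (B' x)) ha ha'
    (hv.comp hB) (hv.comp hB') (fun x => hvb _) (fun x => hvb _)]
  calc ‖∫ z, (v (B z.1) - v (B' z.2)) ∂μ.prod μ'‖ₑ ^ q
      ≤ eLpNorm (fun z : Space n × Space n => v (B z.1) - v (B' z.2)) 1 (μ.prod μ') ^ q := by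
        gcongr
        rw [eLpNorm_one_eq_lintegral_enorm]
        exact enorm_integral_le_lintegral_enorm _
    _ ≤ eLpNorm (fun z : Space n × Space n => v (B z.1) - v (B' z.2)) (ENNReal.ofReal q)
          (μ.prod μ') ^ q := by
        gcongr
        exact eLpNorm_le_eLpNorm_of_exponent_le (by simpa using hq.le) hcont.aestronglyMeasurable
    _ = ∫⁻ z, ‖v (B z.1) - v (B' z.2)‖ₑ ^ q ∂μ.prod μ' := by
        rw [eLpNorm_eq_lintegral_rpow_enorm_toReal (by simpa using hq0) ENNReal.ofReal_ne_top,
          ENNReal.toReal_ofReal hq0.le, ← ENNReal.rpow_mul, one_div, inv_mul_cancel₀ hq0.ne',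
          ENNReal.rpow_one]
    _ = ∫⁻ x, ∫⁻ y, ‖v (B x) - v (B' y)‖ₑ ^ q ∂μ' ∂μ :=
        lintegral_prod _ (hcont.enorm.measurable.pow_const q).aemeasurable
    _ ≤ ∫⁻ x, ∫⁻ y, ENNReal.ofReal (q * 5 ^ (D + t * q) / w₀) * Ψ (B x) (B' y) ∂μ' ∂μ := by
        refine lintegral_mono_ae ?_
        filter_upwards [ae_plateMeasure] with x hx
        refine lintegral_mono_ae ?_
        filter_upwards [ae_plateMeasure] with y hy
        exact hpt x hx y hy
    _ = ENNReal.ofReal (q * 5 ^ (D + t * q) / w₀) * ∫⁻ x, ∫⁻ y, Ψ (B x) (B' y) ∂μ' ∂μ := by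
        rw [← lintegral_const_mul' _ _ ENNReal.ofReal_ne_top]
        congr with x
        rw [lintegral_const_mul' _ _ ENNReal.ofReal_ne_top]
    _ ≤ ENNReal.ofReal (q * 5 ^ (D + t * q) / w₀) * ((volume (plate n a))⁻¹ * (κ *
          ∫⁻ x, ((volume (plate n a'))⁻¹ * (κ * ∫⁻ y, Ψ x y)))) := by
        gcongr
        refine (lintegral_plateMeasure_le _).trans ?_
        gcongr
        refine le_trans (lintegral_mono fun x => ?_)
          (hBκ fun x => (volume (plate n a'))⁻¹ * (κ * ∫⁻ y, Ψ x y))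
        refine (lintegral_plateMeasure_le _).trans ?_
        gcongr
        exact hB'κ _
    _ = ENNReal.ofReal (q * 5 ^ (D + t * q) / w₀) * ((volume (plate n a))⁻¹ * (κ *
          ((volume (plate n a'))⁻¹ * (κ * ∫⁻ x, ∫⁻ y, Ψ x y)))) := by
        rw [lintegral_const_mul' _ _ (ENNReal.inv_ne_top.mpr volume_plate_ne_zero),
          lintegral_const_mul' _ _ hκ]
    _ = _ := by
        rw [phase]
        ring

end Plates
/-! ### Telescoping along the traverses -/

section Chain

variable {n N M K : ℕ} {g : ℝ → ℝ} {α t q : ℝ}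

/-- The identity, or the similarity onto one of the children. -/
noncomputable def place (N : ℕ) : Option (Child n N) → Space n → Space n
  | none => id
  | some i => sub N i

lemma continuous_sub (i : Child n N) : Continuous (sub N i) := by
  unfold sub; fun_prop

lemma continuous_place (o : Option (Child n N)) : Continuous (place N o) := by
  cases o with
  | none => exact continuous_id
  | some i => exact continuous_sub i

lemma place_mem_box (o : Option (Child n N)) {x : Space n} (hx : x ∈ box n) :
    place N o x ∈ box n := by
  cases o with
  | none => exact hx
  | some i => exact sub_mem_box hx

lemma depth_le_depth_place (hN : 0 < N) (hg : RespectsChildren N g) (o : Option (Child n N))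
    (x : Space n) : (4 * N : ℝ)⁻¹ * depth g x ≤ depth g (place N o x) := by
  cases o with
  | none =>
    have : (1 : ℝ) ≤ N := by exact_mod_cast hN
    exact mul_le_of_le_one_left (depth_nonneg x) (inv_le_one_of_one_le₀ (by linarith))
  | some i => exact depth_le_depth_sub hN hg i x

lemma lintegral_comp_place_le (hN : 0 < N) (o : Option (Child n N)) (f : Space n → ENNReal) :
    ∫⁻ x, f (place N o x) ≤ ENNReal.ofReal ((4 * N : ℝ) ^ (n + 1)) * ∫⁻ x, f x := by
  cases o with
  | none =>
    refine le_mul_of_one_le_left zero_le ?_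
    rw [ENNReal.one_le_ofReal]
    have : (1 : ℝ) ≤ N := by exact_mod_cast hN
    exact one_le_pow₀ (by linarith)
  | some i => exact (lintegral_comp_sub hN i f).le

/-- Averages over (images of) plates on which the staircase takes the same value are close for
functions of small energy, with a constant that does not depend on the plates. -/
lemma exists_link_bound (hN : 0 < N) (hg : IsStep g) (hr : RespectsChildren N g) (hα : 0 < α)
    (ht : 0 < t) (hq : 1 < q) :
    ∃ L : ℝ, 0 ≤ L ∧ ∀ (o o' : Option (Child n N)) (a a' : ℝ), (a = 3 / 2 ∨ a = -3 / 2) →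
      (a' = 3 / 2 ∨ a' = -3 / 2) →
      (∀ x ∈ plate n a, ∀ y ∈ plate n a', g (place N o x 0) = g (place N o' y 0)) →
      ∀ (v : Space n → ℝ) (b : ℝ), Continuous v → (∀ x, |v x| ≤ b) →
        phase (n + 1) t q (weight g α) v ≠ ⊤ →
        |∫ x, v (place N o x) ∂plateMeasure n a - ∫ x, v (place N o' x) ∂plateMeasure n a'| ≤
          (L * (phase (n + 1) t q (weight g α) v).toReal) ^ (1 / q) := by
  have hq0 : 0 < q := by linarith
  have hN' : (0 : ℝ) < N := by positivity
  set V : ENNReal := (volume (plate n (3 / 2)))⁻¹ + (volume (plate n (-3 / 2)))⁻¹ with hV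
  have hVt : V ≠ ⊤ := ENNReal.add_ne_top.mpr
    ⟨ENNReal.inv_ne_top.mpr volume_plate_ne_zero, ENNReal.inv_ne_top.mpr volume_plate_ne_zero⟩
  set κ : ENNReal := ENNReal.ofReal ((4 * N : ℝ) ^ (n + 1)) with hκ
  have hκt : κ ≠ ⊤ := ENNReal.ofReal_ne_top
  set ρ : ℝ := (4 * N : ℝ)⁻¹ * (((n : ℝ) + 1)⁻¹ / 4) with hρ
  have hρ0 : 0 < ρ := by positivity
  set Λ : ENNReal := ENNReal.ofReal (q * 5 ^ (((n + 1 : ℕ) : ℝ) + t * q) / ρ ^ α) *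
        (V * κ * (V * κ)) with hΛ
  have hΛt : Λ ≠ ⊤ := ENNReal.mul_ne_top ENNReal.ofReal_ne_top
    (ENNReal.mul_ne_top (ENNReal.mul_ne_top hVt hκt) (ENNReal.mul_ne_top hVt hκt))
  refine ⟨Λ.toReal, ENNReal.toReal_nonneg, fun o o' a a' ha ha' hval v b hv hvb hfin => ?_⟩
  have habs : ∀ {a : ℝ}, (a = 3 / 2 ∨ a = -3 / 2) → |a| = 3 / 2 := by
    rintro a (rfl | rfl) <;> norm_num [abs_of_pos, abs_of_neg]
  have hVa : ∀ {a : ℝ}, (a = 3 / 2 ∨ a = -3 / 2) → (volume (plate n a))⁻¹ ≤ V := by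
    rintro a (rfl | rfl)
    · exact le_self_add
    · exact le_add_self
  have hdepth : ∀ {a : ℝ} (o : Option (Child n N)), (a = 3 / 2 ∨ a = -3 / 2) →
      ∀ x ∈ plate n a, ρ ≤ depth g (place N o x) := fun o ha x hx =>
    (mul_le_mul_of_nonneg_left (le_depth_of_mem_plate hg (habs ha) hx) (by positivity)).trans
      (depth_le_depth_place hN hr o x)
  have key := enorm_integral_sub_rpow_le (g := g) (α := α) (w₀ := ρ ^ α) hq ht (by positivity)
    (habs ha) (habs ha') hκt (continuous_place o) (continuous_place o')
    (lintegral_comp_place_le hN o) (lintegral_comp_place_le hN o')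
    (fun x hx => place_mem_box o (plate_subset_box (habs ha) hx))
    (fun x hx => place_mem_box o' (plate_subset_box (habs ha') hx)) ?_ hv hvb
  · have h2 : ‖∫ x, v (place N o x) ∂plateMeasure n a -
        ∫ x, v (place N o' x) ∂plateMeasure n a'‖ₑ ^ q
          ≤ Λ * phase (n + 1) t q (weight g α) v := by
      refine key.trans ?_
      rw [hΛ]
      have h3 := hVa ha
      have h4 := hVa ha'
      gcongr
    have h5 := ENNReal.toReal_mono (ENNReal.mul_ne_top hΛt hfin) h2
    rw [ENNReal.toReal_mul, ← ENNReal.toReal_rpow, toReal_enorm, Real.norm_eq_abs] at h5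
    rw [one_div]
    exact (Real.le_rpow_inv_iff_of_pos (abs_nonneg _)
      (mul_nonneg ENNReal.toReal_nonneg ENNReal.toReal_nonneg) hq0).mpr h5
  · intro x hx y hy
    rw [weight, if_pos (hval x hx y hy)]
    exact Real.rpow_le_rpow hρ0.le (le_min (hdepth o ha x hx) (hdepth o' ha' y hy)) hα.le

/-- Telescoping along a chain whose consecutive members are almost linked. -/
lemma abs_sub_sub_sum_le {x y : ℕ → ℝ} {A B Λ : ℝ} {m : ℕ} (hA : |x 0 - A| ≤ Λ)
    (hB : |y m - B| ≤ Λ) (hl : ∀ j < m, |x (j + 1) - y j| ≤ Λ) :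
    |(B - A) - ∑ j ∈ Finset.range (m + 1), (y j - x j)| ≤ (m + 2) * Λ := by
  have key : ∀ k ≤ m, |(y k - A) - ∑ j ∈ Finset.range (k + 1), (y j - x j)| ≤ (k + 1) * Λ := by
    intro k
    induction k with
    | zero =>
      intro _
      have : y 0 - A - ∑ j ∈ Finset.range (0 + 1), (y j - x j) = x 0 - A := by simp
      rw [this]
      simpa using hA
    | succ k ih =>
      intro hk
      rw [Finset.sum_range_succ]
      have h1 := abs_le.mp (ih (by omega))
      have h2 := abs_le.mp (hl k (by omega))
      push_cast
      rw [abs_le]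
      constructor <;> linarith
  have h1 := abs_le.mp (key m le_rfl)
  have h2 := abs_le.mp hB
  rw [abs_le]
  constructor <;> linarith

lemma sum_range_mul (f : ℕ → ℝ) (M K : ℕ) :
    ∑ k ∈ Finset.range (M * K), f k =
      ∑ κ ∈ Finset.range K, ∑ j ∈ Finset.range M, f (M * κ + j) := by
  induction K with
  | zero => simp
  | succ K ih => rw [Nat.mul_succ, Finset.sum_range_add, ih, Finset.sum_range_succ]

/-- The staircase is self-similar: its restriction to the `i`-th child interval is
`fold ((i + g) / M)`. -/
def IsSelfSimilar (M K : ℕ) (g : ℝ → ℝ) : Prop :=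
  ∀ i < M * K, ∀ y, |y| ≤ 2 →
    g (y / (4 * (M * K : ℕ)) + center (M * K) i) = fold ((i + g y) / M)

lemma IsSelfSimilar.respectsChildren (hs : IsSelfSimilar M K g) :
    RespectsChildren (M * K) g := by
  intro i hi y z hy hz h
  rw [hs i hi y hy, hs i hi z hz, h]

lemma IsSelfSimilar.sub_left (hs : IsSelfSimilar M K g) (hg : IsStep g) (i : Child n (M * K))
    {x : Space n} (hx : x ∈ plate n (-3 / 2)) :
    g (sub (M * K) i x 0) = fold ((i.1 : ℕ) / M) := by
  have h1 := plate_subset_box (by norm_num [abs_of_neg]) hx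
  have h2 := abs_lt.mp hx.1
  rw [sub_apply_zero, hs _ i.1.2 _ h1.1.le, hg.left _ (by linarith), add_zero]

lemma IsSelfSimilar.sub_right (hs : IsSelfSimilar M K g) (hg : IsStep g) (i : Child n (M * K))
    {x : Space n} (hx : x ∈ plate n (3 / 2)) :
    g (sub (M * K) i x 0) = fold (((i.1 : ℕ) + 1) / M) := by
  have h1 := plate_subset_box (by norm_num [abs_of_pos]) hx
  have h2 := abs_lt.mp hx.1
  rw [sub_apply_zero, hs _ i.1.2 _ h1.1.le, hg.right _ (by linarith)]

/-- One of the `K` traverses of the staircase between the values `0` and `1` already bounds the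
drop of `v` by the drops of its rescalings to the `M` children on this traverse. The traverses
of even index go up, those of odd index go down. -/
lemma abs_drop_le_traverse (hM : 0 < M) (hg : IsStep g) (hs : IsSelfSimilar M K g)
    {v : Space n → ℝ} {Λ : ℝ}
    (hΛ : ∀ (o o' : Option (Child n (M * K))) (a a' : ℝ), (a = 3 / 2 ∨ a = -3 / 2) →
      (a' = 3 / 2 ∨ a' = -3 / 2) →
      (∀ x ∈ plate n a, ∀ y ∈ plate n a',
        g (place (M * K) o x 0) = g (place (M * K) o' y 0)) →
      |∫ x, v (place (M * K) o x) ∂plateMeasure n a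
        - ∫ x, v (place (M * K) o' x) ∂plateMeasure n a'| ≤ Λ)
    (m : Fin n → Fin (4 * (M * K))) {κ : ℕ} (hκ : κ < K) :
    |drop v| ≤ (M + 1) * Λ + ∑ j ∈ Finset.range M,
      if h : M * κ + j < M * K then |drop (v ∘ sub (M * K) (⟨M * κ + j, h⟩, m))| else 0 := by
  have hM' : (M : ℝ) ≠ 0 := by positivity
  have hlt : ∀ j < M, M * κ + j < M * K := fun j hj =>
    calc M * κ + j < M * (κ + 1) := by rw [Nat.mul_succ]; omega
      _ ≤ M * K := Nat.mul_le_mul_left M hκ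
  let P : ℝ → ℕ → ℝ := fun a j => if h : M * κ + j < M * K then
    ∫ x, v (sub (M * K) (⟨M * κ + j, h⟩, m) x) ∂plateMeasure n a else 0
  have hP : ∀ a j (h : j < M), P a j =
      ∫ x, v (place (M * K) (some (⟨M * κ + j, hlt j h⟩, m)) x) ∂plateMeasure n a := fun a j h => by
    simp only [P, dif_pos (hlt j h)]
    rfl
  have hg0 : ∀ x ∈ plate n (-3 / 2), g (x 0) = 0 := fun x hx =>
    hg.left _ (by linarith [(abs_lt.mp hx.1).2])
  have hg1 : ∀ x ∈ plate n (3 / 2), g (x 0) = 1 := fun x hx =>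
    hg.right _ (by linarith [(abs_lt.mp hx.1).1])
  have hval0 : fold (((M * κ + 0 : ℕ) : ℝ) / M) = (1 - (-1) ^ κ) / 2 := by
    rw [← fold_natCast]; congr 1; push_cast; field_simp; ring
  obtain ⟨M', rfl⟩ : ∃ M', M = M' + 1 := ⟨M - 1, by omega⟩
  have hval1 : fold ((((M' + 1) * κ + M' : ℕ) + 1 : ℝ) / (M' + 1 : ℕ))
      = (1 - (-1) ^ (κ + 1)) / 2 := by
    rw [← fold_natCast]; congr 1; field_simp; push_cast; ring
  -- the right plate of a child and the left plate of the next one carry the same value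
  have hlink : ∀ j < M', |P (-3 / 2) (j + 1) - P (3 / 2) j| ≤ Λ := by
    intro j hj
    rw [hP _ _ (by omega), hP _ _ (by omega)]
    refine hΛ _ _ _ _ (Or.inr rfl) (Or.inl rfl) fun x hx y hy => ?_
    simp only [place]
    rw [hs.sub_left hg _ hx, hs.sub_right hg _ hy]
    congr 2
    push_cast
    ring
  have hsum : |∑ j ∈ Finset.range (M' + 1), (P (3 / 2) j - P (-3 / 2) j)| ≤
      ∑ j ∈ Finset.range (M' + 1), if h : (M' + 1) * κ + j < (M' + 1) * K then
        |drop (v ∘ sub ((M' + 1) * K) (⟨(M' + 1) * κ + j, h⟩, m))| else 0 := by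
    refine (Finset.abs_sum_le_sum_abs _ _).trans (Finset.sum_le_sum fun j hj => ?_)
    have hj' := hlt j (Finset.mem_range.mp hj)
    simp only [P, dif_pos hj', drop, Function.comp_apply]
    exact le_rfl
  have hends : ∀ a' b' : ℝ, (a' = 3 / 2 ∨ a' = -3 / 2) → (b' = 3 / 2 ∨ b' = -3 / 2) →
      (∀ y ∈ plate n a', g (y 0) = (1 - (-1) ^ κ) / 2) →
      (∀ y ∈ plate n b', g (y 0) = (1 - (-1) ^ (κ + 1)) / 2) →
      |(∫ x, v x ∂plateMeasure n b' - ∫ x, v x ∂plateMeasure n a') -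
        ∑ j ∈ Finset.range (M' + 1), (P (3 / 2) j - P (-3 / 2) j)| ≤ (M' + 2) * Λ := by
    intro a' b' ha' hb' hga hgb
    refine abs_sub_sub_sum_le ?_ ?_ hlink
    · rw [hP _ _ (by omega)]
      refine hΛ _ none _ _ (Or.inr rfl) ha' fun x hx y hy => ?_
      simp only [place, id]
      rw [hs.sub_left hg _ hx, hga y hy]
      exact hval0
    · rw [hP _ _ (by omega)]
      refine hΛ _ none _ _ (Or.inl rfl) hb' fun x hx y hy => ?_
      simp only [place, id]
      rw [hs.sub_right hg _ hx, hgb y hy]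
      exact hval1
  have hM2 : ((M' + 1 : ℕ) : ℝ) + 1 = M' + 2 := by push_cast; ring
  rw [hM2]
  have hfin : ∀ S X : ℝ, |X - S| ≤ (M' + 2) * Λ → |X| ≤ (M' + 2) * Λ + |S| := by
    intro S X h
    have := abs_add_le (X - S) S
    rw [sub_add_cancel] at this
    linarith
  refine le_trans ?_ (add_le_add le_rfl hsum)
  rcases Nat.even_or_odd κ with hκ' | hκ'
  · refine hfin _ _ (hends (-3 / 2) (3 / 2) (Or.inr rfl) (Or.inl rfl) ?_ ?_)
    · intro y hy; rw [hg0 y hy, hκ'.neg_one_pow]; norm_num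
    · intro y hy; rw [hg1 y hy, hκ'.add_one.neg_one_pow]; norm_num
  · have h := hfin _ _ (hends (3 / 2) (-3 / 2) (Or.inl rfl) (Or.inr rfl) ?_ ?_)
    · rwa [abs_sub_comm] at h
    · intro y hy; rw [hg1 y hy, hκ'.neg_one_pow]; norm_num
    · intro y hy; rw [hg0 y hy, hκ'.add_one.neg_one_pow]; norm_num

/-- Average of `abs_drop_le_traverse` over all traverses and all subdivisions of the transversal
directions. -/
lemma abs_drop_le_sum (hM : 0 < M) (hK : 0 < K) (hg : IsStep g) (hs : IsSelfSimilar M K g)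
    {v : Space n → ℝ} {Λ : ℝ}
    (hΛ : ∀ (o o' : Option (Child n (M * K))) (a a' : ℝ), (a = 3 / 2 ∨ a = -3 / 2) →
      (a' = 3 / 2 ∨ a' = -3 / 2) →
      (∀ x ∈ plate n a, ∀ y ∈ plate n a',
        g (place (M * K) o x 0) = g (place (M * K) o' y 0)) →
      |∫ x, v (place (M * K) o x) ∂plateMeasure n a
        - ∫ x, v (place (M * K) o' x) ∂plateMeasure n a'| ≤ Λ) :
    |drop v| ≤ (M + 1) * Λ + (K * (4 * (M * K : ℕ) : ℝ) ^ n)⁻¹ *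
      ∑ i : Child n (M * K), |drop (v ∘ sub (M * K) i)| := by
  have hM' : (0 : ℝ) < M := by positivity
  have hK' : (0 : ℝ) < K := by positivity
  set T : ℝ := K * (4 * (M * K : ℕ) : ℝ) ^ n with hT
  have hT0 : 0 < T := by positivity
  have h1 : T * |drop v| ≤ T * ((M + 1) * Λ) +
      ∑ i : Child n (M * K), |drop (v ∘ sub (M * K) i)| := by
    have hm : ∀ m : Fin n → Fin (4 * (M * K)), K * |drop v| ≤ K * ((M + 1) * Λ) +
        ∑ k : Fin (M * K), |drop (v ∘ sub (M * K) (k, m))| := by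
      intro m
      have h2 : ∑ k : Fin (M * K), |drop (v ∘ sub (M * K) (k, m))| =
          ∑ k ∈ Finset.range (M * K), if h : k < M * K then
            |drop (v ∘ sub (M * K) (⟨k, h⟩, m))| else 0 := by
        rw [← Fin.sum_univ_eq_sum_range]
        refine Finset.sum_congr rfl fun k _ => ?_
        rw [dif_pos k.2]
      rw [h2, sum_range_mul]
      calc (K : ℝ) * |drop v| = ∑ _κ ∈ Finset.range K, |drop v| := by simp
        _ ≤ ∑ κ ∈ Finset.range K, ((M + 1) * Λ + ∑ j ∈ Finset.range M,
            if h : M * κ + j < M * K then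
              |drop (v ∘ sub (M * K) (⟨M * κ + j, h⟩, m))| else 0) :=
            Finset.sum_le_sum fun κ hκ =>
              abs_drop_le_traverse hM hg hs hΛ m (Finset.mem_range.mp hκ)
        _ = _ := by rw [Finset.sum_add_distrib]; simp
    have hcard : ((Finset.univ : Finset (Fin n → Fin (4 * (M * K)))).card : ℝ)
        = (4 * (M * K : ℕ) : ℝ) ^ n := by
      simp
    rw [Fintype.sum_prod_type_right]
    calc T * |drop v| = ∑ _m : Fin n → Fin (4 * (M * K)), K * |drop v| := by
          rw [Finset.sum_const, nsmul_eq_mul, hcard, hT]; ring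
      _ ≤ ∑ m : Fin n → Fin (4 * (M * K)), (K * ((M + 1) * Λ) +
            ∑ k : Fin (M * K), |drop (v ∘ sub (M * K) (k, m))|) :=
          Finset.sum_le_sum fun m _ => hm m
      _ = _ := by
          rw [Finset.sum_add_distrib, Finset.sum_const, nsmul_eq_mul, hcard, hT]; ring
  have h2 := mul_le_mul_of_nonneg_left h1 (inv_nonneg.mpr hT0.le)
  rwa [mul_add, inv_mul_cancel_left₀ hT0.ne', inv_mul_cancel_left₀ hT0.ne'] at h2

lemma abs_drop_le_of_lipschitz {v : Space n → ℝ} {ℓ b : ℝ}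
    (hl : ∀ x y, |v x - v y| ≤ ℓ * ‖x - y‖) (hc : Continuous v) (hb : ∀ x, |v x| ≤ b) :
    |drop v| ≤ ℓ * 5 := by
  have h1 : |(3 / 2 : ℝ)| = 3 / 2 := by norm_num [abs_of_pos]
  have h2 : |(-3 / 2 : ℝ)| = 3 / 2 := by norm_num [abs_of_neg]
  have := isProbabilityMeasure_plateMeasure (n := n) h1
  have := isProbabilityMeasure_plateMeasure (n := n) h2
  have hl0 : 0 ≤ ℓ := by
    have := (abs_nonneg _).trans (hl (EuclideanSpace.single 0 1) 0)
    simpa using this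
  rw [drop, integral_sub_integral_eq h1 h2 hc hc hb hb]
  have := norm_integral_le_of_norm_le_const (μ := (plateMeasure n (3 / 2)).prod
    (plateMeasure n (-3 / 2))) (f := fun z : Space n × Space n => v z.1 - v z.2) (C := ℓ * 5) ?_
  · simpa using this
  · have e1 := Measure.quasiMeasurePreserving_fst (μ := plateMeasure n (3 / 2))
      (ν := plateMeasure n (-3 / 2))
    have e2 := Measure.quasiMeasurePreserving_snd (μ := plateMeasure n (3 / 2))
      (ν := plateMeasure n (-3 / 2))
    filter_upwards [e1.ae ae_plateMeasure, e2.ae ae_plateMeasure] with z hz1 hz2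
    refine (hl _ _).trans (mul_le_mul_of_nonneg_left ?_ hl0)
    have h3 := norm_lt_of_mem_box (plate_subset_box h1 hz1)
    have h4 := norm_lt_of_mem_box (plate_subset_box h2 hz2)
    have := norm_sub_le z.1 z.2
    linarith

end Chain

/-! ### The energy controls the drop, and the choice of parameters -/

section DropBound

variable {n M K : ℕ} {g : ℝ → ℝ} {α t q : ℝ}

/-- The factor by which the energy bound for the drop improves from one generation to the next:
the prefactor in `abs_drop_le_sum`, times the constant that Hölder's inequality over the
`M * (K * R ^ n)` children and the scaling of the energy produce, where `R = 4 * (M * K)`. -/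
noncomputable def contraction (n M K : ℕ) (α t q : ℝ) : ℝ :=
  (K * (4 * (M * K : ℕ) : ℝ) ^ n)⁻¹ *
    ((M * (K * (4 * (M * K : ℕ) : ℝ) ^ n)) ^ (q - 1) *
      (4 * (M * K : ℕ) : ℝ) ^ (((n + 1 : ℕ) : ℝ) - t * q + α)) ^ (1 / q)

lemma contraction_lt_one (hM : 0 < M) (hK : 0 < K) (hq : 1 < q)
    (h : 4 * (M : ℝ) ^ q * (4 * (M * K : ℕ) : ℝ) ^ α < (4 * (M * K : ℕ) : ℝ) ^ (t * q)) :
    contraction n M K α t q < 1 := by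
  have hM' : (0 : ℝ) < M := by positivity
  have hK' : (0 : ℝ) < K := by positivity
  have hq0 : 0 < q := by linarith
  set R : ℝ := 4 * (M * K : ℕ) with hR
  have hR0 : 0 < R := by positivity
  have hRMK : R = 4 * (M * K) := by rw [hR]; push_cast; ring
  set T : ℝ := K * R ^ n with hT
  have hT0 : 0 < T := by positivity
  have hbase : (M * T) ^ (q - 1) * R ^ (((n + 1 : ℕ) : ℝ) - t * q + α) < T ^ q := by
    have hMT : M * T = R ^ (n + 1) / 4 := by rw [hT, pow_succ]; rw [hRMK]; ring
    rw [Real.rpow_sub (by positivity), Real.rpow_one, Real.mul_rpow hM'.le hT0.le,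
      Real.rpow_add hR0, Real.rpow_sub hR0, Real.rpow_natCast, hMT]
    have e : (M : ℝ) ^ q * T ^ q / (R ^ (n + 1) / 4) * (R ^ (n + 1) / R ^ (t * q) * R ^ α)
        = T ^ q * ((4 * (M : ℝ) ^ q * R ^ α) / R ^ (t * q)) := by
      field_simp
    rw [e]
    refine mul_lt_of_lt_one_right (by positivity) ?_
    rwa [div_lt_one (by positivity)]
  rw [contraction, ← hR, ← hT, inv_mul_lt_one₀ hT0, one_div]
  exact (Real.rpow_inv_lt_iff_of_pos (by positivity) hT0.le hq0).mpr hbase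

/-- The inverse inequality behind the gap: the energy of a Lipschitz function controls its drop
across the staircase, uniformly in the Lipschitz constant. The Lipschitz constant enters only
through a remainder that is divided by four in each generation. -/
theorem exists_abs_drop_le (hM : 0 < M) (hK : 0 < K) (hg : IsStep g) (hs : IsSelfSimilar M K g)
    (hα : 0 < α) (ht : 0 < t) (hq : 1 < q)
    (h : 4 * (M : ℝ) ^ q * (4 * (M * K : ℕ) : ℝ) ^ α < (4 * (M * K : ℕ) : ℝ) ^ (t * q)) :
    ∃ C : ℝ, ∀ (v : Space n → ℝ) (ℓ b : ℝ), (∀ x y, |v x - v y| ≤ ℓ * ‖x - y‖) →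
      Continuous v → (∀ x, |v x| ≤ b) → phase (n + 1) t q (weight g α) v ≠ ⊤ →
      |drop v| ≤ C * (phase (n + 1) t q (weight g α) v).toReal ^ (1 / q) := by
  have hN : 0 < M * K := Nat.mul_pos hM hK
  have hM' : (0 : ℝ) < M := by positivity
  have hK' : (1 : ℝ) ≤ K := by exact_mod_cast hK
  have hq0 : 0 < q := by linarith
  have hr := hs.respectsChildren
  obtain ⟨L, hL0, hL⟩ := exists_link_bound (n := n) hN hg hr hα ht hq
  set R : ℝ := 4 * (M * K : ℕ) with hR
  have hR0 : 0 < R := by positivity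
  have hRMK : R = 4 * (M * K) := by rw [hR]; push_cast; ring
  set T : ℝ := K * R ^ n with hT
  have hT0 : 0 < T := by positivity
  set c := contraction n M K α t q with hc
  have hc1 : c < 1 := contraction_lt_one hM hK hq h
  have hcard : ((Finset.univ : Finset (Child n (M * K))).card : ℝ) = M * T := by
    simp [hT, hR]; ring
  let en : (Space n → ℝ) → ℝ := fun v => (phase (n + 1) t q (weight g α) v).toReal
  have hen0 : ∀ v, 0 ≤ en v := fun v => ENNReal.toReal_nonneg
  have hfin : ∀ v, phase (n + 1) t q (weight g α) v ≠ ⊤ → ∀ i : Child n (M * K),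
      phase (n + 1) t q (weight g α) (v ∘ sub (M * K) i) ≠ ⊤ := fun v hv =>
    ENNReal.sum_ne_top.mp (ne_top_of_le_ne_top (ENNReal.mul_ne_top ENNReal.ofReal_ne_top hv)
      (sum_phase_comp_sub_le hN hr hα hq0 v)) |> fun h i => h i (Finset.mem_univ i)
  -- Hölder's inequality over the children, combined with the scaling of the energy
  have hsum : ∀ v, phase (n + 1) t q (weight g α) v ≠ ⊤ →
      T⁻¹ * ∑ i : Child n (M * K), en (v ∘ sub (M * K) i) ^ (1 / q) ≤ c * en v ^ (1 / q) := by
    intro v hv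
    have h1 : ∑ i : Child n (M * K), en (v ∘ sub (M * K) i) ≤
        R ^ (((n + 1 : ℕ) : ℝ) - t * q + α) * en v := by
      have := ENNReal.toReal_mono (ENNReal.mul_ne_top ENNReal.ofReal_ne_top hv)
        (sum_phase_comp_sub_le hN hr hα hq0 v)
      rwa [ENNReal.toReal_sum fun i _ => hfin v hv i, ENNReal.toReal_mul,
        ENNReal.toReal_ofReal (by positivity)] at this
    have h2 := Real.rpow_sum_le_const_mul_sum_rpow_of_nonneg
      (Finset.univ : Finset (Child n (M * K))) (f := fun i => en (v ∘ sub (M * K) i) ^ (1 / q))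
      hq.le fun i _ => Real.rpow_nonneg (hen0 _) _
    simp only [← Real.rpow_mul (hen0 _), one_div, inv_mul_cancel₀ hq0.ne', Real.rpow_one] at h2
    rw [hcard] at h2
    have h3 : ∑ i : Child n (M * K), en (v ∘ sub (M * K) i) ^ (1 / q) ≤
        ((M * T) ^ (q - 1) * R ^ (((n + 1 : ℕ) : ℝ) - t * q + α) * en v) ^ (1 / q) := by
      rw [one_div]
      refine (Real.le_rpow_inv_iff_of_pos
        (Finset.sum_nonneg fun i _ => Real.rpow_nonneg (hen0 _) _)
        (mul_nonneg (by positivity) (hen0 v)) hq0).mpr (h2.trans ?_)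
      rw [mul_assoc]
      gcongr
    rw [Real.mul_rpow (by positivity) (hen0 v)] at h3
    calc T⁻¹ * ∑ i : Child n (M * K), en (v ∘ sub (M * K) i) ^ (1 / q)
        ≤ T⁻¹ * (((M * T) ^ (q - 1) * R ^ (((n + 1 : ℕ) : ℝ) - t * q + α)) ^ (1 / q)
            * en v ^ (1 / q)) := by gcongr
      _ = c * en v ^ (1 / q) := by rw [hc, contraction, ← hR, ← hT]; ring
  set A : ℝ := (M + 1) * L ^ (1 / q) with hA
  have hA0 : 0 ≤ A := by positivity
  have hone : ∀ (v : Space n → ℝ) (b : ℝ), Continuous v → (∀ x, |v x| ≤ b) →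
      phase (n + 1) t q (weight g α) v ≠ ⊤ →
      |drop v| ≤ A * en v ^ (1 / q) + T⁻¹ * ∑ i : Child n (M * K), |drop (v ∘ sub (M * K) i)| := by
    intro v b hv hb hf
    have := abs_drop_le_sum hM hK hg hs (v := v) (Λ := (L * en v) ^ (1 / q))
      fun o o' a a' ha ha' hval => hL o o' a a' ha ha' hval v b hv hb hf
    rwa [Real.mul_rpow hL0 (hen0 v), ← mul_assoc] at this
  -- `A / (1 - c)` is the fixed point of `X ↦ A + c * X`
  have hiter : ∀ (k : ℕ) (v : Space n → ℝ) (ℓ b : ℝ), (∀ x y, |v x - v y| ≤ ℓ * ‖x - y‖) →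
      Continuous v → (∀ x, |v x| ≤ b) → phase (n + 1) t q (weight g α) v ≠ ⊤ →
      |drop v| ≤ A / (1 - c) * en v ^ (1 / q) + (1 / 4) ^ k * (ℓ * 5) := by
    intro k
    induction k with
    | zero =>
      intro v ℓ b hl hv hb _
      have h1 := abs_drop_le_of_lipschitz hl hv hb
      have h2 : 0 ≤ A / (1 - c) * en v ^ (1 / q) :=
        mul_nonneg (div_nonneg hA0 (by linarith)) (Real.rpow_nonneg (hen0 v) _)
      linarith
    | succ k ih =>
      intro v ℓ b hl hv hb hf
      have hl0 : 0 ≤ ℓ := by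
        have := (abs_nonneg _).trans (hl (EuclideanSpace.single 0 1) 0)
        simpa using this
      have h1 : ∀ i : Child n (M * K), |drop (v ∘ sub (M * K) i)| ≤
          A / (1 - c) * en (v ∘ sub (M * K) i) ^ (1 / q) + (1 / 4) ^ k * (R⁻¹ * ℓ * 5) := by
        intro i
        refine ih _ (R⁻¹ * ℓ) b (fun x y => ?_) (hv.comp (continuous_sub i)) (fun x => hb _)
          (hfin v hf i)
        refine (hl _ _).trans (le_of_eq ?_)
        rw [norm_sub_sub]
        ring
      calc |drop v| ≤ A * en v ^ (1 / q) +
            T⁻¹ * ∑ i : Child n (M * K), |drop (v ∘ sub (M * K) i)| := hone v b hv hb hf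
        _ ≤ A * en v ^ (1 / q) + T⁻¹ * ∑ i : Child n (M * K),
            (A / (1 - c) * en (v ∘ sub (M * K) i) ^ (1 / q)
              + (1 / 4) ^ k * (R⁻¹ * ℓ * 5)) := by
            gcongr with i
            exact h1 i
        _ = A * en v ^ (1 / q) + A / (1 - c) * (T⁻¹ * ∑ i : Child n (M * K),
            en (v ∘ sub (M * K) i) ^ (1 / q)) + (M * R⁻¹) * ((1 / 4) ^ k * (ℓ * 5)) := by
            rw [Finset.sum_add_distrib, ← Finset.mul_sum, Finset.sum_const, nsmul_eq_mul, hcard]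
            linear_combination (M * (1 / 4) ^ k * R⁻¹ * ℓ * 5) * inv_mul_cancel₀ hT0.ne'
        _ ≤ A * en v ^ (1 / q) + A / (1 - c) * (c * en v ^ (1 / q))
            + (1 / 4) * ((1 / 4) ^ k * (ℓ * 5)) := by
            have h2 := hsum v hf
            have h3 : M * R⁻¹ ≤ 1 / 4 := by
              rw [← div_eq_mul_inv, div_le_div_iff₀ hR0 (by norm_num), hRMK]
              nlinarith
            have h4 : 0 ≤ A / (1 - c) := div_nonneg hA0 (by linarith)
            gcongr
        _ = _ := by
            have : 1 - c ≠ 0 := by linarith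
            field_simp
            ring
  refine ⟨A / (1 - c), fun v ℓ b hl hv hb hf => ?_⟩
  have hlim : Filter.Tendsto (fun k : ℕ => A / (1 - c) * en v ^ (1 / q) + (1 / 4) ^ k * (ℓ * 5))
      Filter.atTop (nhds (A / (1 - c) * en v ^ (1 / q) + 0 * (ℓ * 5))) :=
    ((tendsto_pow_atTop_nhds_zero_of_lt_one (by norm_num) (by norm_num)).mul_const _).const_add _
  rw [zero_mul, add_zero] at hlim
  exact ge_of_tendsto' hlim fun k => hiter k v ℓ b hl hv hb hf

end DropBound

section Parameters

/-- The numbers of steps and of traverses can be chosen so that the staircase has Hölder exponent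
greater than `s` while the energy bound contracts. -/
lemma exists_parameters {s t q : ℝ} (hs : 0 < s) (hst : s < t) (ht : t < 1) (hq : 1 < q) :
    ∃ (σ : ℝ) (α : NNReal) (M K : ℕ), s < σ ∧ σ ≤ 1 ∧ 0 < α ∧ α ≤ 1 ∧ 0 < M ∧ Odd K ∧
      2 * (4 * (M * K : ℕ) : ℝ) ^ σ ≤ M ∧
      4 * (M : ℝ) ^ q * (4 * (M * K : ℕ) : ℝ) ^ (α : ℝ) < (4 * (M * K : ℕ) : ℝ) ^ (t * q) := by
  have hq0 : 0 < q := by linarith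
  obtain ⟨σ, hσ1, hσ2⟩ := exists_between hst
  obtain ⟨τ, hτ1, hτ2⟩ := exists_between hσ2
  obtain ⟨ρ, hρ1, hρ2⟩ := exists_between hτ1
  have hσ0 : 0 < σ := hs.trans hσ1
  have hρ0 : 0 < ρ := hσ0.trans hρ1
  have hτ0 : 0 < τ := hρ0.trans hρ2
  set a : ℝ := min 1 ((t - τ) * q / 2) with ha
  have ha0 : 0 < a := lt_min one_pos (by have := mul_pos (sub_pos.mpr hτ2) hq0; linarith)
  have ha2 : a ≤ (t - τ) * q / 2 := min_le_right _ _
  -- `M ≈ x ^ ρ` and `K ≈ 2 x ^ (1 - ρ)` for large `x`, so that `x ≤ R ≤ 40 x`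
  have hlarge : ∀ (c e : ℝ), 0 < e → ∀ᶠ x : ℝ in Filter.atTop, c < x ^ e := fun c e he =>
    (tendsto_rpow_atTop he).eventually_gt_atTop c
  obtain ⟨x, hx1, hx2, hx3, hx4⟩ := ((Filter.eventually_ge_atTop (1 : ℝ)).and
    ((hlarge (2 * 40 ^ σ) (ρ - σ) (by linarith)).and ((hlarge 2 (τ - ρ) (by linarith)).and
      (hlarge 4 ((t - τ) * q - a)
        (by have := mul_pos (sub_pos.mpr hτ2) hq0; linarith))))).exists
  have hx0 : 0 < x := by linarith
  set M : ℕ := ⌈x ^ ρ⌉₊ with hM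
  set K : ℕ := 2 * ⌈x ^ (1 - ρ)⌉₊ + 1 with hK
  have hM1 : x ^ ρ ≤ M := Nat.le_ceil _
  have hM2 : (M : ℝ) ≤ 2 * x ^ ρ := by
    have h1 := (Nat.ceil_lt_add_one (by positivity : 0 ≤ x ^ ρ)).le
    have h2 := Real.one_le_rpow hx1 hρ0.le
    linarith
  have hK1 : x ^ (1 - ρ) ≤ K := by
    rw [hK]; push_cast
    have := Nat.le_ceil (x ^ (1 - ρ))
    have h2 : 0 < x ^ (1 - ρ) := by positivity
    linarith
  have hK2 : (K : ℝ) ≤ 5 * x ^ (1 - ρ) := by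
    rw [hK]; push_cast
    have h1 := (Nat.ceil_lt_add_one (by positivity : 0 ≤ x ^ (1 - ρ))).le
    have h2 := Real.one_le_rpow hx1 (by linarith : 0 ≤ 1 - ρ)
    linarith
  have hxx : x ^ ρ * x ^ (1 - ρ) = x := by
    rw [← Real.rpow_add hx0]; simp
  set R : ℝ := 4 * (M * K : ℕ) with hR
  have hR1 : x ≤ R := by
    have : x ^ ρ * x ^ (1 - ρ) ≤ M * K := mul_le_mul hM1 hK1 (by positivity) (by positivity)
    rw [hR]; push_cast; linarith
  have hR2 : R ≤ 40 * x := by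
    have : (M : ℝ) * K ≤ 2 * x ^ ρ * (5 * x ^ (1 - ρ)) :=
      mul_le_mul hM2 hK2 (by positivity) (by positivity)
    rw [hR]; push_cast; linarith
  have hR0 : 0 < R := by linarith
  refine ⟨σ, ⟨a, ha0.le⟩, M, K, hσ1, by linarith, by exact_mod_cast ha0,
    by exact_mod_cast (min_le_left _ _ : a ≤ 1), Nat.ceil_pos.mpr (by positivity), ⟨_, rfl⟩, ?_, ?_⟩
  · calc 2 * R ^ σ ≤ 2 * (40 * x) ^ σ := by gcongr
      _ = (2 * 40 ^ σ) * x ^ σ := by rw [Real.mul_rpow (by norm_num) hx0.le]; ring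
      _ ≤ x ^ (ρ - σ) * x ^ σ := by gcongr
      _ = x ^ ρ := by rw [← Real.rpow_add hx0]; simp
      _ ≤ M := hM1
  · have hMτ : (M : ℝ) ≤ R ^ τ := by
      calc (M : ℝ) ≤ 2 * x ^ ρ := hM2
        _ ≤ x ^ (τ - ρ) * x ^ ρ := by gcongr
        _ = x ^ τ := by rw [← Real.rpow_add hx0]; simp
        _ ≤ R ^ τ := by gcongr
    have h4 : 4 < R ^ ((t - τ) * q - a) := by
      refine hx4.trans_le (Real.rpow_le_rpow hx0.le hR1 ?_)
      have := mul_pos (sub_pos.mpr hτ2) hq0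
      linarith
    change 4 * (M : ℝ) ^ q * R ^ a < R ^ (t * q)
    calc 4 * (M : ℝ) ^ q * R ^ a ≤ 4 * (R ^ τ) ^ q * R ^ a := by gcongr
      _ < R ^ ((t - τ) * q - a) * (R ^ τ) ^ q * R ^ a := by gcongr
      _ = R ^ (t * q) := by
        rw [← Real.rpow_mul hR0.le, ← Real.rpow_add hR0, ← Real.rpow_add hR0]
        congr 1; ring

end Parameters

/-! ### The competitor and the gap -/

section PhaseAlgebra

variable {d : ℕ} {s p : ℝ} {b : EuclideanSpace ℝ (Fin d) → EuclideanSpace ℝ (Fin d) → ℝ}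
  {v w : EuclideanSpace ℝ (Fin d) → ℝ}

lemma phase_const_mul {m : ℝ} (hm : 0 ≤ m) (v : EuclideanSpace ℝ (Fin d) → ℝ) :
    phase d s p (fun x y => m * b x y) v = ENNReal.ofReal m * phase d s p b v := by
  unfold phase
  rw [← lintegral_const_mul' _ _ ENNReal.ofReal_ne_top]
  congr with x
  rw [← lintegral_const_mul' _ _ ENNReal.ofReal_ne_top]
  congr with y
  rw [← ENNReal.ofReal_mul hm]
  congr 1
  ring

lemma phase_eq_mul_phase_div {r : ℝ} (hr : 0 < r) (v : EuclideanSpace ℝ (Fin d) → ℝ) :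
    phase d s p b v = ENNReal.ofReal (r ^ p) * phase d s p b (fun x => v x / r) := by
  unfold phase
  rw [← lintegral_const_mul' _ _ ENNReal.ofReal_ne_top]
  congr with x
  rw [← lintegral_const_mul' _ _ ENNReal.ofReal_ne_top]
  congr with y
  rw [← ENNReal.ofReal_mul (by positivity), ← sub_div, abs_div, abs_of_pos hr,
    Real.div_rpow (abs_nonneg _) hr.le]
  congr 1
  have : r ^ p ≠ 0 := by positivity
  field_simp

lemma phase_congr (h : ∀ x y, b x y ≠ 0 → |v x - v y| = |w x - w y|) :
    phase d s p b v = phase d s p b w := by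
  unfold phase
  congr with x
  congr with y
  by_cases hb : b x y = 0
  · simp [hb]
  · rw [h x y hb]

/-- The quasi-triangle inequality for the fractional phase. -/
lemma phase_sub_le (hp : 1 < p) (hb0 : ∀ x y, 0 ≤ b x y)
    (hb : Measurable fun z : EuclideanSpace ℝ (Fin d) × EuclideanSpace ℝ (Fin d) => b z.1 z.2)
    (hv : AEMeasurable v) :
    phase d s p b (fun x => v x - w x) ≤
      ENNReal.ofReal (2 ^ p) * (phase d s p b v + phase d s p b w) := by
  have hp0 : 0 < p := by linarith
  have hmeas : AEMeasurable (fun z : EuclideanSpace ℝ (Fin d) × EuclideanSpace ℝ (Fin d) =>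
      ENNReal.ofReal (1 / p * (b z.1 z.2 * (|v z.1 - v z.2| ^ p
        / ‖z.1 - z.2‖ ^ ((d : ℝ) + s * p))))) (volume.prod volume) := by
    have h1 : AEMeasurable (fun z : EuclideanSpace ℝ (Fin d) × EuclideanSpace ℝ (Fin d) =>
        |v z.1 - v z.2| ^ p) (volume.prod volume) :=
      ((hv.comp_quasiMeasurePreserving Measure.quasiMeasurePreserving_fst).sub
        (hv.comp_quasiMeasurePreserving Measure.quasiMeasurePreserving_snd)).abs.pow_const p
    have h2 : Measurable fun z : EuclideanSpace ℝ (Fin d) × EuclideanSpace ℝ (Fin d) =>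
        ‖z.1 - z.2‖ ^ ((d : ℝ) + s * p) := by fun_prop
    exact ((hb.aemeasurable.mul (h1.div h2.aemeasurable)).const_mul _).ennreal_ofReal
  have hmeas' : ∀ x, AEMeasurable fun y => ENNReal.ofReal (1 / p * (b x y * (|v x - v y| ^ p
        / ‖x - y‖ ^ ((d : ℝ) + s * p)))) := by
    intro x
    have h1 : AEMeasurable fun y => |v x - v y| ^ p := (hv.const_sub _).abs.pow_const p
    have h2 : Measurable fun y => ‖x - y‖ ^ ((d : ℝ) + s * p) := by fun_prop
    exact (((hb.comp measurable_prodMk_left).aemeasurable.mul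
      (h1.div h2.aemeasurable)).const_mul _).ennreal_ofReal
  unfold phase
  rw [← lintegral_add_left' hmeas.lintegral_prod_right',
    ← lintegral_const_mul' _ _ ENNReal.ofReal_ne_top]
  refine lintegral_mono fun x => ?_
  simp only
  rw [← lintegral_add_left' (hmeas' x), ← lintegral_const_mul' _ _ ENNReal.ofReal_ne_top]
  refine lintegral_mono fun y => ?_
  have hpos : ∀ f : EuclideanSpace ℝ (Fin d) → ℝ,
      0 ≤ 1 / p * (b x y * (|f x - f y| ^ p / ‖x - y‖ ^ ((d : ℝ) + s * p))) := fun f => by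
    have := hb0 x y
    positivity
  simp only
  rw [← ENNReal.ofReal_add (hpos v) (hpos w), ← ENNReal.ofReal_mul (by positivity)]
  apply ENNReal.ofReal_le_ofReal
  have h1 : |v x - w x - (v y - w y)| ^ p ≤ 2 ^ p * (|v x - v y| ^ p + |w x - w y| ^ p) := by
    have h2 : |v x - w x - (v y - w y)| ≤ 2 * max |v x - v y| |w x - w y| := by
      have e : v x - w x - (v y - w y) = (v x - v y) - (w x - w y) := by ring
      have h3 := abs_sub (v x - v y) (w x - w y)
      rw [e]
      linarith [le_max_left |v x - v y| |w x - w y|, le_max_right |v x - v y| |w x - w y|]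
    refine (Real.rpow_le_rpow (abs_nonneg _) h2 hp0.le).trans ?_
    rw [Real.mul_rpow (by norm_num) (le_max_of_le_left (abs_nonneg _))]
    gcongr
    rcases max_choice |v x - v y| |w x - w y| with h | h <;> rw [h]
    · exact le_add_of_nonneg_right (by positivity)
    · exact le_add_of_nonneg_left (by positivity)
  have hb' := hb0 x y
  calc 1 / p * (b x y * (|v x - w x - (v y - w y)| ^ p / ‖x - y‖ ^ ((d : ℝ) + s * p)))
      ≤ 1 / p * (b x y * (2 ^ p * (|v x - v y| ^ p + |w x - w y| ^ p)
          / ‖x - y‖ ^ ((d : ℝ) + s * p))) := by gcongr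
    _ = _ := by ring

end PhaseAlgebra

section BoundedHolder

/-- Bounded Hölder continuous functions of exponent `σ`. -/
def IsBoundedHolder {n : ℕ} (σ : ℝ) (f : Space n → ℝ) : Prop :=
  ∃ C, (∀ x y, |f x - f y| ≤ C * ‖x - y‖ ^ σ) ∧ ∀ x, |f x| ≤ C

variable {n : ℕ} {σ : ℝ} {f h : Space n → ℝ}

lemma IsBoundedHolder.sub (hf : IsBoundedHolder σ f) (hh : IsBoundedHolder σ h) :
    IsBoundedHolder σ fun x => f x - h x := by
  obtain ⟨C, h1, h2⟩ := hf
  obtain ⟨C', h1', h2'⟩ := hh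
  refine ⟨C + C', fun x y => ?_, fun x => ?_⟩
  · have e : f x - h x - (f y - h y) = (f x - f y) - (h x - h y) := by ring
    rw [e, add_mul]
    exact (abs_sub _ _).trans (add_le_add (h1 x y) (h1' x y))
  · exact (abs_sub _ _).trans (add_le_add (h2 x) (h2' x))

lemma IsBoundedHolder.neg (hf : IsBoundedHolder σ f) : IsBoundedHolder σ fun x => -f x := by
  obtain ⟨C, h1, h2⟩ := hf
  refine ⟨C, fun x y => ?_, fun x => by rw [abs_neg]; exact h2 x⟩
  rw [neg_sub_neg, abs_sub_comm]
  exact h1 x y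

lemma IsBoundedHolder.mul (hf : IsBoundedHolder σ f) (hh : IsBoundedHolder σ h) :
    IsBoundedHolder σ fun x => f x * h x := by
  obtain ⟨C, h1, h2⟩ := hf
  obtain ⟨C', h1', h2'⟩ := hh
  have hC : 0 ≤ C := (abs_nonneg _).trans (h2 0)
  have hC' : 0 ≤ C' := (abs_nonneg _).trans (h2' 0)
  refine ⟨2 * (C * C'), fun x y => ?_, fun x => ?_⟩
  · have e : f x * h x - f y * h y = f x * (h x - h y) + (f x - f y) * h y := by ring
    rw [e]
    refine (abs_add_le _ _).trans ?_
    rw [abs_mul, abs_mul]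
    calc |f x| * |h x - h y| + |f x - f y| * |h y|
        ≤ C * (C' * ‖x - y‖ ^ σ) + C * ‖x - y‖ ^ σ * C' := by
          have := h1 x y
          have := h1' x y
          have := h2 x
          have := h2' y
          gcongr
      _ = _ := by ring
  · rw [abs_mul]
    have : |f x| * |h x| ≤ C * C' := mul_le_mul (h2 x) (h2' x) (abs_nonneg _) hC
    nlinarith [mul_nonneg hC hC']

lemma IsBoundedHolder.continuous (hσ : 0 < σ) (hf : IsBoundedHolder σ f) : Continuous f := by
  obtain ⟨C, h1, -⟩ := hf
  rw [continuous_iff_continuousAt]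
  intro x
  rw [ContinuousAt, tendsto_iff_dist_tendsto_zero]
  refine squeeze_zero (fun y => dist_nonneg) (fun y => h1 y x) ?_
  have hc : Continuous fun y : Space n => C * ‖y - x‖ ^ σ :=
    continuous_const.mul ((continuous_id.sub continuous_const).norm.rpow_const
      fun _ => Or.inr hσ.le)
  exact hc.tendsto' _ _ (by simp [Real.zero_rpow hσ.ne'])

lemma isBoundedHolder_of_contDiff (hσ : 0 < σ) (hσ1 : σ ≤ 1) (hf : ContDiff ℝ ∞ f)
    (hc : HasCompactSupport f) : IsBoundedHolder σ f := by
  obtain ⟨ℓ, hℓ⟩ := hf.lipschitzWith_of_hasCompactSupport hc (by simp)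
  obtain ⟨B, hB⟩ := hc.exists_bound_of_continuous hf.continuous
  have hB0 : 0 ≤ B := (norm_nonneg _).trans (hB 0)
  refine ⟨ℓ + 2 * B, fun x y => ?_, fun x => ?_⟩
  · by_cases hxy : ‖x - y‖ ≤ 1
    · calc |f x - f y| ≤ ℓ * ‖x - y‖ := by
            have := hℓ.dist_le_mul x y
            rwa [Real.dist_eq, dist_eq_norm] at this
        _ ≤ (ℓ + 2 * B) * ‖x - y‖ ^ σ := by
            gcongr
            · linarith
            · exact Real.self_le_rpow_of_le_one (norm_nonneg _) hxy hσ1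
    · have h1 : |f x - f y| ≤ 2 * B := by
        refine (abs_sub _ _).trans ?_
        have := hB x
        have := hB y
        rw [Real.norm_eq_abs] at *
        linarith
      have h2 := Real.one_le_rpow (not_le.mp hxy).le hσ.le
      have : (0 : ℝ) ≤ ℓ := ℓ.2
      nlinarith
  · have := hB x
    rw [Real.norm_eq_abs] at this
    have : (0 : ℝ) ≤ ℓ := ℓ.2
    linarith

lemma IsBoundedHolder.phase_lt_top {s p M r : ℝ} (hf : IsBoundedHolder σ f) (hs : 0 < s)
    (hsσ : s < σ) (hp : 0 < p) (hf0 : ∀ x, r ≤ ‖x‖ → f x = 0)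
    {b : Space n → Space n → ℝ} (hbM : ∀ x y, b x y ≤ M) :
    phase (n + 1) s p b f < ⊤ := by
  obtain ⟨C, h1, h2⟩ := hf
  exact DoublePhase.phase_lt_top hs hsσ hp h1 h2 hf0 hbM

end BoundedHolder

section Competitor

variable {n : ℕ} {g : ℝ → ℝ}

/-- A cut-off equal to `1` on `box n` with support in `3Ω`. -/
noncomputable def outerBump (n : ℕ) : ContDiffBump (0 : Space n) :=
  ⟨5 / 2, 3, by norm_num, by norm_num⟩

/-- A cut-off supported in `Ω` equal to `1` on the part of `box n` where the staircase varies. -/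
noncomputable def innerBump (n : ℕ) : ContDiffBump (0 : Space n) :=
  ⟨3 / 4, 1, by norm_num, by norm_num⟩

/-- The boundary datum: a smooth step from `0` to `1` in the direction of coordinate `0`. -/
noncomputable def datum (n : ℕ) (x : Space n) : ℝ :=
  outerBump n x * Real.smoothTransition (x 0 + 1 / 2)

/-- The difference between the competitor and the boundary datum: inside `Ω`, near `box n`, the
smooth step is replaced by the staircase. -/
noncomputable def correction (g : ℝ → ℝ) (x : Space n) : ℝ :=
  innerBump n x * (g (x 0) - Real.smoothTransition (x 0 + 1 / 2))

lemma abs_apply_le_norm (x : Space n) (l : Fin (n + 1)) : |x l| ≤ ‖x‖ := by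
  have := PiLp.norm_apply_le x l
  rwa [Real.norm_eq_abs] at this

lemma le_norm_of_notMem_cube {r : ℝ} {x : Space n} (hx : x ∉ cube (n + 1) r) : r ≤ ‖x‖ := by
  by_contra h
  push Not at h
  exact hx fun l => abs_lt.mp ((abs_apply_le_norm x l).trans_lt h)

lemma contDiff_step : ContDiff ℝ ∞ fun x : Space n => Real.smoothTransition (x 0 + 1 / 2) := by
  refine Real.smoothTransition.contDiff.comp (ContDiff.add ?_ contDiff_const)
  fun_prop

lemma contDiff_datum : ContDiff ℝ ∞ (datum n) := (outerBump n).contDiff.mul contDiff_step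

lemma hasCompactSupport_datum : HasCompactSupport (datum n) :=
  (outerBump n).hasCompactSupport.mul_right

lemma datum_eq_zero {x : Space n} (hx : 3 ≤ ‖x‖) : datum n x = 0 := by
  rw [datum, (outerBump n).zero_of_le_dist (by simpa [outerBump] using hx), zero_mul]

lemma datum_eq_step {x : Space n} (hx : x ∈ box n) :
    datum n x = Real.smoothTransition (x 0 + 1 / 2) := by
  rw [datum, (outerBump n).one_of_mem_closedBall, one_mul]
  simpa [outerBump] using (norm_lt_of_mem_box hx).le

lemma correction_eq_zero {x : Space n} (hx : 1 ≤ ‖x‖) : correction g x = 0 := by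
  rw [correction, (innerBump n).zero_of_le_dist (by simpa [innerBump] using hx), zero_mul]

/-- In the box, the competitor `datum n + correction g` is the staircase. -/
lemma datum_add_correction (hg : IsStep g) {x : Space n} (hx : x ∈ box n) :
    datum n x + correction g x = g (x 0) := by
  rw [datum_eq_step hx, correction]
  by_cases h : |x 0| ≤ 1 / 2
  · rw [(innerBump n).one_of_mem_closedBall, one_mul, add_sub_cancel]
    have h1 := norm_sq_lt_of_mem_box hx
    have h2 : x 0 ^ 2 ≤ (1 / 2) ^ 2 := sq_le_sq' (by linarith [(abs_le.mp h).1]) (abs_le.mp h).2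
    have : ‖x‖ ≤ 3 / 4 := by nlinarith [norm_nonneg x]
    simpa [innerBump] using this
  · rcases lt_abs.mp (not_le.mp h) with h | h
    · rw [hg.right _ h.le, Real.smoothTransition.one_of_one_le (by linarith)]; simp
    · rw [hg.left _ (by linarith), Real.smoothTransition.zero_of_nonpos (by linarith)]; simp

lemma isBoundedHolder_correction {σ R : ℝ} (hσ : 0 < σ) (hσ1 : σ ≤ 1) (hR : 1 ≤ R)
    (hg : IsStep g) (hH : ∀ x y, |g x - g y| ≤ (R * |x - y|) ^ σ) :
    IsBoundedHolder σ (correction (n := n) g) := by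
  have h1 : IsBoundedHolder σ (innerBump n) :=
    isBoundedHolder_of_contDiff hσ hσ1 (innerBump n).contDiff (innerBump n).hasCompactSupport
  have h2 : IsBoundedHolder σ fun x : Space n =>
      innerBump n x * Real.smoothTransition (x 0 + 1 / 2) :=
    isBoundedHolder_of_contDiff hσ hσ1 ((innerBump n).contDiff.mul contDiff_step)
      (innerBump n).hasCompactSupport.mul_right
  have h3 : IsBoundedHolder σ fun x : Space n => g (x 0) := by
    refine ⟨R ^ σ, fun x y => ?_, fun x => ?_⟩
    · rw [← Real.mul_rpow (by linarith) (norm_nonneg _)]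
      refine (hH _ _).trans (Real.rpow_le_rpow (by positivity) ?_ hσ.le)
      gcongr
      exact abs_apply_le_norm (x - y) 0
    · rw [abs_of_nonneg (hg.nonneg _)]
      exact (hg.le_one _).trans (Real.one_le_rpow hR hσ.le)
  have h4 := (h1.mul h3).sub h2
  have e : correction (n := n) g = fun x => innerBump n x * g (x 0) -
      innerBump n x * Real.smoothTransition (x 0 + 1 / 2) := by
    ext x; rw [correction]; ring
  rwa [e]

/-- Functions with the boundary values of the datum have drop `1`. -/
lemma drop_eq_one {φ : Space n → ℝ} (hφ : ∀ x, x ∉ cube (n + 1) 1 → φ x = 0) :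
    drop (fun x => datum n x + φ x) = 1 := by
  have h1 : |(3 / 2 : ℝ)| = 3 / 2 := by norm_num [abs_of_pos]
  have h2 : |(-3 / 2 : ℝ)| = 3 / 2 := by norm_num [abs_of_neg]
  have := isProbabilityMeasure_plateMeasure (n := n) h1
  have := isProbabilityMeasure_plateMeasure (n := n) h2
  have e1 : ∫ x, (datum n x + φ x) ∂plateMeasure n (3 / 2) = 1 := by
    rw [integral_congr_ae (g := fun _ => (1 : ℝ))]
    · simp
    filter_upwards [ae_plateMeasure] with x hx
    have h0 := abs_lt.mp hx.1
    rw [datum_eq_step (plate_subset_box h1 hx), Real.smoothTransition.one_of_one_le (by linarith),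
      hφ, add_zero]
    exact fun h => by linarith [(h 0).2]
  have e2 : ∫ x, (datum n x + φ x) ∂plateMeasure n (-3 / 2) = 0 := by
    rw [integral_congr_ae (g := fun _ => (0 : ℝ))]
    · simp
    filter_upwards [ae_plateMeasure] with x hx
    have h0 := abs_lt.mp hx.1
    rw [datum_eq_step (plate_subset_box h2 hx), Real.smoothTransition.zero_of_nonpos (by linarith),
      hφ, add_zero]
    exact fun h => by linarith [(h 0).1]
  rw [drop, e1, e2, sub_zero]

end Competitor

section Gap

variable {n : ℕ} {g : ℝ → ℝ} {s t p q α σ : ℝ}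

/-- On pairs of points charged by the weight, the competitor takes equal values. -/
lemma competitor_eq_of_weight_ne_zero (hα : 0 < α) (hg : IsStep g) {x y : Space n}
    (h : weight g α x y ≠ 0) :
    datum n x + correction g x = datum n y + correction g y := by
  have h1 : ¬(x ∉ flatSet n g ∨ y ∉ flatSet n g ∨ g (x 0) ≠ g (y 0)) :=
    fun hc => h (weight_eq_zero hα hc)
  push Not at h1
  rw [datum_add_correction hg h1.1.1, datum_add_correction hg h1.2.1.1, h1.2.2]

/-- The weighted phase of a test function with the boundary values of the datum is bounded
below. -/
lemma exists_le_phase_datum_add (hα : 0 < α) (ht : 0 < t) (ht1 : t < 1) (hq : 1 < q) {C : ℝ}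
    (hC : ∀ (v : Space n → ℝ) (ℓ b : ℝ), (∀ x y, |v x - v y| ≤ ℓ * ‖x - y‖) →
      Continuous v → (∀ x, |v x| ≤ b) → phase (n + 1) t q (weight g α) v ≠ ⊤ →
      |drop v| ≤ C * (phase (n + 1) t q (weight g α) v).toReal ^ (1 / q)) :
    ∃ c : ℝ, 0 < c ∧ ∀ φ ∈ testFunctions (cube (n + 1) 1),
      ENNReal.ofReal c ≤ phase (n + 1) t q (weight g α) fun x => datum n x + φ x := by
  have hq0 : 0 < q := by linarith
  refine ⟨(1 / (|C| + 1)) ^ q, by positivity, ?_⟩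
  rintro φ ⟨hφ1, hφ2, hφ3⟩
  have hsm : ContDiff ℝ ∞ fun x => datum n x + φ x := contDiff_datum.add hφ1
  have hcs : HasCompactSupport fun x => datum n x + φ x := hasCompactSupport_datum.add hφ2
  have hH := isBoundedHolder_of_contDiff one_pos le_rfl hsm hcs
  obtain ⟨r, hr⟩ := hcs.isCompact.isBounded.subset_ball (0 : Space n)
  have hr0 : ∀ x, r ≤ ‖x‖ → datum n x + φ x = 0 := fun x hx =>
    image_eq_zero_of_notMem_tsupport (f := fun x => datum n x + φ x) fun hxt =>
      absurd (mem_ball_zero_iff.mp (hr hxt)) (not_lt.mpr hx)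
  have hfin := (hH.phase_lt_top ht ht1 hq0 hr0 (weight_le (g := g) hα)).ne
  obtain ⟨ℓ, h1, h2⟩ := hH
  simp only [Real.rpow_one] at h1
  have hd := hC _ ℓ ℓ h1 hsm.continuous h2 hfin
  rw [drop_eq_one fun x hx => image_eq_zero_of_notMem_tsupport fun h => hx (hφ3 h), abs_one] at hd
  rw [ENNReal.ofReal_le_iff_le_toReal hfin]
  set e := (phase (n + 1) t q (weight g α) fun x => datum n x + φ x).toReal with he
  have he0 : 0 ≤ e := ENNReal.toReal_nonneg
  have h3 : 1 / (|C| + 1) ≤ e ^ (1 / q) := by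
    rw [div_le_iff₀ (by positivity)]
    have h4 : 0 ≤ e ^ (1 / q) := by positivity
    nlinarith [le_abs_self C]
  calc (1 / (|C| + 1)) ^ q ≤ (e ^ (1 / q)) ^ q := Real.rpow_le_rpow (by positivity) h3 hq0.le
    _ = e := by rw [← Real.rpow_mul he0, one_div, inv_mul_cancel₀ hq0.ne', Real.rpow_one]

/-- The lower bound of the weighted phase passes from test functions to their closure with respect
to the Luxemburg norm of the double phase energy. -/
lemma exists_le_phase_of_mem_H (hq : 1 < q) {c : ℝ} (hc : 0 < c)
    (hmeas : Measurable fun z : Space n × Space n => weight g α z.1 z.2)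
    (hφ : ∀ φ ∈ testFunctions (cube (n + 1) 1),
      ENNReal.ofReal c ≤ phase (n + 1) t q (weight g α) fun x => datum n x + φ x) :
    ∃ c' : ℝ, 0 < c' ∧ ∀ m : ℝ, 1 ≤ m →
      ∀ v ∈ H (energy (n + 1) s t p q fun x y => m * weight g α x y) (cube (n + 1) 1) (datum n),
        ENNReal.ofReal c' ≤ phase (n + 1) t q (weight g α) v := by
  have hq0 : 0 < q := by linarith
  have h2q : (0 : ℝ) < 2 ^ q := by positivity
  refine ⟨c / 2 / 2 ^ q, by positivity, ?_⟩
  rintro m hm v ⟨w, ⟨⟨hw, -, -⟩, happ⟩, rfl⟩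
  -- half of `c` is to survive the quasi-triangle inequality with constant `2 ^ q`
  set ε : ℝ := (c / 2 / 2 ^ q) ^ (1 / q) with hε
  have hε0 : 0 < ε := by positivity
  have hεq : ε ^ q = c / 2 / 2 ^ q := by
    rw [hε, ← Real.rpow_mul (by positivity), one_div, inv_mul_cancel₀ hq0.ne', Real.rpow_one]
  obtain ⟨φ, hφt, hnorm⟩ := happ (ENNReal.ofReal ε) (by simpa using hε0)
  simp only [luxemburgNorm, iInf_lt_iff] at hnorm
  obtain ⟨r, hr0, hrJ, hrε⟩ := hnorm
  rw [ENNReal.ofReal_lt_ofReal_iff hε0] at hrε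
  have hsmall : phase (n + 1) t q (weight g α) (fun x => w x - φ x) ≤ ENNReal.ofReal (ε ^ q) := by
    -- the factor `m ≥ 1` in the energy only helps
    have h1 : phase (n + 1) t q (weight g α) (fun x => (w x - φ x) / r) ≤ 1 := by
      refine le_trans ?_ (le_add_self.trans hrJ)
      rw [phase_const_mul (by linarith)]
      exact le_mul_of_one_le_left zero_le (by simpa using hm)
    rw [phase_eq_mul_phase_div hr0]
    calc ENNReal.ofReal (r ^ q) * phase (n + 1) t q (weight g α) (fun x => (w x - φ x) / r)
        ≤ ENNReal.ofReal (r ^ q) * 1 := by gcongr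
      _ ≤ ENNReal.ofReal (ε ^ q) := by
        rw [mul_one]
        exact ENNReal.ofReal_le_ofReal (Real.rpow_le_rpow hr0.le hrε.le hq0.le)
  have hmv : AEMeasurable (datum n + w) :=
    contDiff_datum.continuous.aemeasurable.add hw.aestronglyMeasurable.aemeasurable
  have hsplit := phase_sub_le (s := t) hq (weight_nonneg α) hmeas hmv
    (w := fun x => w x - φ x)
  have hfun : (fun x => (datum n + w) x - (w x - φ x)) = fun x => datum n x + φ x := by
    ext x; simp only [Pi.add_apply]; ring
  rw [hfun] at hsplit
  set e := phase (n + 1) t q (weight g α) (datum n + w) with he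
  by_contra hlt
  push Not at hlt
  have h1 : ENNReal.ofReal c < ENNReal.ofReal c := by
    calc ENNReal.ofReal c ≤ _ := hφ φ hφt
      _ ≤ ENNReal.ofReal (2 ^ q) * (e + ENNReal.ofReal (ε ^ q)) := hsplit.trans (by gcongr)
      _ < ENNReal.ofReal (2 ^ q) * (ENNReal.ofReal (c / 2 / 2 ^ q) + ENNReal.ofReal (ε ^ q)) := by
          refine (ENNReal.mul_lt_mul_iff_right (by simpa using h2q) ENNReal.ofReal_ne_top).mpr ?_
          exact ENNReal.add_lt_add_right ENNReal.ofReal_ne_top hlt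
      _ = ENNReal.ofReal c := by
          rw [hεq, ← ENNReal.ofReal_add (by positivity) (by positivity),
            ← ENNReal.ofReal_mul h2q.le]
          congr 1
          field_simp
          norm_num
  exact lt_irrefl _ h1

end Gap

end DoublePhase

theorem theorem1p1 (d : ℕ) (hd : 2 ≤ d) (s t p q : ℝ)
    (hs : 0 < s) (hst : s < t) (ht : t < 1) (hp : 1 < p) (hq : 1 < q)
    (hind : s - (d : ℝ) / p < t - (d : ℝ) / q) :
    ∃ (a : EuclideanSpace ℝ (Fin d) → EuclideanSpace ℝ (Fin d) → ℝ)
      (uD : EuclideanSpace ℝ (Fin d) → ℝ),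
      -- the weight: nonnegative, symmetric, measurable, bounded, Hölder continuous,
      -- vanishing outside `3Ω × 3Ω`
      (∀ x y, 0 ≤ a x y) ∧
      (∀ x y, a x y = a y x) ∧
      Measurable (fun z : EuclideanSpace ℝ (Fin d) × EuclideanSpace ℝ (Fin d) => a z.1 z.2) ∧
      (∃ M : ℝ, ∀ x y, a x y ≤ M) ∧
      (∃ α C : NNReal, 0 < α ∧ α ≤ 1 ∧
        HolderWith C α
          (fun z : EuclideanSpace ℝ (Fin d) × EuclideanSpace ℝ (Fin d) => a z.1 z.2)) ∧
      (∀ x y, x ∉ DoublePhase.cube d 3 ∨ y ∉ DoublePhase.cube d 3 → a x y = 0) ∧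
      -- the boundary datum: in `C^∞` of the closed cube, in `L^∞`, vanishing outside `3Ω`
      ContDiffOn ℝ ∞ uD (closure (DoublePhase.cube d 1)) ∧
      MemLp uD ⊤ volume ∧
      (∀ x, x ∉ DoublePhase.cube d 3 → uD x = 0) ∧
      -- the energy gap
      sInf (DoublePhase.energy d s t p q a ''
          DoublePhase.W (DoublePhase.energy d s t p q a) (DoublePhase.cube d 1) uD) <
        sInf (DoublePhase.energy d s t p q a ''
          DoublePhase.H (DoublePhase.energy d s t p q a) (DoublePhase.cube d 1) uD) := by
  open DoublePhase in
  obtain ⟨n, rfl⟩ : ∃ n, d = n + 1 := ⟨d - 1, by omega⟩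
  have ht0 : 0 < t := hs.trans hst
  have hp0 : 0 < p := by linarith
  have hq0 : 0 < q := by linarith
  obtain ⟨σ, α, M, K, hsσ, hσ1, hα, hα1, hM, hK, hMσ, hMα⟩ := exists_parameters hs hst ht hq
  have hσ : 0 < σ := hs.trans hsσ
  have hα' : (0 : ℝ) < α := by exact_mod_cast hα
  obtain ⟨g, hg, hgH, hgs⟩ := exists_staircase hM hK hσ hσ1 hMσ
  obtain ⟨C, hC⟩ := exists_abs_drop_le (n := n) hM hK.pos hg hgs hα' ht0 hq hMα
  have hhol := holderWith_weight (n := n) (g := g) hα hα1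
  have hmeas : Measurable fun z : Space n × Space n => weight g α z.1 z.2 :=
    (hhol.continuous hα).measurable
  obtain ⟨c, hc, hcφ⟩ := exists_le_phase_datum_add hα' ht0 ht hq hC
  obtain ⟨c', hc', hcH⟩ := exists_le_phase_of_mem_H (s := s) (p := p) hq hc hmeas hcφ
  have hcor : IsBoundedHolder σ (correction (n := n) g) := by
    refine isBoundedHolder_correction hσ hσ1 ?_ hg hgH
    have : (1 : ℝ) ≤ (M * K : ℕ) := by exact_mod_cast Nat.mul_pos hM hK.pos
    linarith
  have hdat : ∀ {τ : ℝ}, 0 < τ → τ ≤ 1 → IsBoundedHolder τ (datum n) := fun h0 h1 =>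
    isBoundedHolder_of_contDiff h0 h1 contDiff_datum hasCompactSupport_datum
  -- the energy of the competitor: the weighted phase does not contribute, whatever the factor `m`
  set P : ENNReal := phase (n + 1) s p (fun _ _ => 1) (fun x => datum n x + correction g x) with hP
  have hPt : P < ⊤ := by
    have h1 : IsBoundedHolder σ fun x => datum n x + correction g x := by
      simpa using (hdat hσ hσ1).sub hcor.neg
    refine h1.phase_lt_top hs hsσ hp0 (r := 3) (M := 1) (fun x hx => ?_) fun _ _ => le_rfl
    rw [datum_eq_zero hx, correction_eq_zero (by linarith), add_zero]
  -- with this factor the lower bound `m * c'` on `H` exceeds the energy `P` of the competitor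
  set m : ℝ := max 1 ((P.toReal + 1) / c') with hm
  have hm1 : 1 ≤ m := le_max_left _ _
  have hm0 : 0 ≤ m := by linarith
  have hmc : P.toReal + 1 ≤ m * c' := by
    rw [← div_le_iff₀ hc']
    exact le_max_right _ _
  refine ⟨fun x y => m * weight g α x y, datum n, fun x y => mul_nonneg hm0 (weight_nonneg _ _ _),
    fun x y => congrArg (m * ·) (weight_comm _ x y), hmeas.const_mul m,
    ⟨m * 4 ^ (α : ℝ), fun x y => mul_le_mul_of_nonneg_left (weight_le hα' x y) hm0⟩,
    ⟨α, m.toNNReal, hα, hα1, ?_⟩, ?_, contDiff_datum.contDiffOn, ?_,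
    fun x hx => datum_eq_zero (le_norm_of_notMem_cube hx), ?_⟩
  · intro z z'
    have h1 := hhol z z'
    rw [ENNReal.coe_one, one_mul] at h1
    have h2 : edist (m * weight g α z.1 z.2) (m * weight g α z'.1 z'.2) =
        ENNReal.ofReal m * edist (weight g α z.1 z.2) (weight g α z'.1 z'.2) := by
      rw [edist_dist, edist_dist, Real.dist_eq, Real.dist_eq, ← mul_sub, abs_mul, abs_of_nonneg hm0,
        ENNReal.ofReal_mul hm0]
    exact h2.trans_le (mul_le_mul_right h1 _)
  · intro x y h
    have hbox : ∀ z : Space n, z ∉ cube (n + 1) 3 → z ∉ flatSet n g := fun z hz hzf => by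
      have h1 := le_norm_of_notMem_cube hz
      have h2 := norm_lt_of_mem_box hzf.1
      linarith
    exact mul_eq_zero_of_right _
      (weight_eq_zero hα' (h.imp (hbox x) fun h => Or.inl (hbox y h)))
  · obtain ⟨B, -, hB⟩ := hdat one_pos le_rfl
    exact memLp_top_of_bound contDiff_datum.continuous.aestronglyMeasurable B
      (Filter.Eventually.of_forall hB)
  · have hzero : phase (n + 1) t q (fun x y => m * weight g α x y)
        (fun x => datum n x + correction g x) = 0 := by
      rw [phase_congr (w := fun _ => 0)]
      · simp [phase, Real.zero_rpow hq0.ne']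
      · intro x y hxy
        rw [competitor_eq_of_weight_ne_zero hα' hg (right_ne_zero_of_mul hxy)]
        simp
    have hcorE : energy (n + 1) s t p q (fun x y => m * weight g α x y) (correction g) < ⊤ := by
      refine ENNReal.add_lt_top.mpr ⟨?_, ?_⟩
      · exact hcor.phase_lt_top hs hsσ hp0 (fun x hx => correction_eq_zero hx) (M := 1)
          fun _ _ => le_rfl
      · -- where the weight charges, the competitor is constant, so datum and correction cancel
        rw [phase_congr (w := datum n)]
        · exact (hdat one_pos le_rfl).phase_lt_top ht0 ht hq0 (fun x hx => datum_eq_zero hx)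
            fun x y => mul_le_mul_of_nonneg_left (weight_le hα' x y) hm0
        · intro x y hxy
          have h1 := competitor_eq_of_weight_ne_zero hα' hg (right_ne_zero_of_mul hxy)
          rw [show correction g x - correction g y = -(datum n x - datum n y) by linarith, abs_neg]
    calc sInf (energy (n + 1) s t p q (fun x y => m * weight g α x y) ''
          W (energy (n + 1) s t p q fun x y => m * weight g α x y) (cube (n + 1) 1) (datum n))
        ≤ energy (n + 1) s t p q (fun x y => m * weight g α x y)
            (fun x => datum n x + correction g x) := by
          refine sInf_le ⟨_, ⟨correction g, ⟨?_, hcorE, ?_⟩, rfl⟩, rfl⟩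
          · exact (hcor.continuous hσ).locallyIntegrable
          · exact Filter.Eventually.of_forall fun x hx =>
              correction_eq_zero (le_norm_of_notMem_cube hx)
      _ = P := by rw [energy, hzero, add_zero]
      _ = ENNReal.ofReal P.toReal := (ENNReal.ofReal_toReal hPt.ne).symm
      _ < ENNReal.ofReal (m * c') := by
          rw [ENNReal.ofReal_lt_ofReal_iff (by positivity)]
          linarith
      _ ≤ _ := by
          refine le_sInf ?_
          rintro _ ⟨v, hv, rfl⟩
          refine le_trans ?_ le_add_self
          rw [phase_const_mul hm0, ENNReal.ofReal_mul hm0]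
          gcongr
          exact hcH m hm1 v hv
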